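/- Let $n\ge 1$ be an integer and let $1<p<\infty$, $1<q<\infty$ and $0<\gamma<1$. For $x\in\mathbb R^n$, $t\in\mathbb R$ and $L>0$ let $Q(x,L)=\{y\in\mathbb R^n:\ |y_i-x_i|\le L,\ i=1,\dots,n\}$, and let $R=R(x,t,L)=Q(x,L)\times(t-L^p,t+L^p)\subset\mathbb R^{n+1}$ be the parabolic rectangle with upper and lower parts $$R^+(\gamma)=Q(x,L)\times(t+\gamma L^p,\,t+L^p),\qquad R^-(\gamma)=Q(x,L)\times(t-L^p,\,t-\gamma L^p).$$ For $f\in L^1_{\mathrm{loc}}(\mathbb R^{n+1})$ let $$M^{\gamma+}f(x,t)=\sup_{R^-(\gamma)\ni(x,t)}\frac1{|R^+(\gamma)|}\int_{R^+(\gamma)}|f|$$ be the uncentered forward in time parabolic maximal function. A weight is a nonnegative locally integrable function $w$ on $\mathbb R^{n+1}$, and $w\in A_q^+(\gamma)$ means that $$[w]_{A_q^+(\gamma)}=\sup_{R}\Bigl(\frac1{|R^-(\gamma)|}\int_{R^-(\gamma)}w\Bigr)\Bigl(\frac1{|R^+(\gamma)|}\int_{R^+(\gamma)}w^{\frac1{1-q}}\Bigr)^{q-1}<\infty,$$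 the supremum being over all parabolic rectangles $R\subset\mathbb R^{n+1}$ (with $w^{1/(1-q)}=\infty$ where $w=0$, and $0\cdot\infty=0$). **Theorem.** Let $w$ be a weight. Then $w\in A_q^+(\gamma)$ if and only if there exists a constant $C>0$ such that $$\int_{\mathbb R^{n+1}}(M^{\gamma+}f)^q\,w\le C\int_{\mathbb R^{n+1}}|f|^q\,w\qquad\text{for every } f\in L^1_{\mathrm{loc}}(\mathbb R^{n+1}).$$ Moreover, if $w\in A_q^+(\gamma)$, then the constant $C$ can be chosen to depend only on $n$, $p$, $q$, $\gamma$ and $[w]_{A_q^+(\gamma)}$. -/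

import Mathlib

open MeasureTheory
open scoped ENNReal

noncomputable section

namespace ParabolicWeights

/-- Space-time `ℝ^{n+1} = ℝ^n × ℝ`, with points `(x, t)`; its `volume` is Lebesgue measure. -/
abbrev SpaceTime (n : ℕ) : Type := (Fin n → ℝ) × ℝ

/-- The closed cube `Q(x, L) = {y : |y_i - x_i| ≤ L for all i}`. -/
def cube {n : ℕ} (x : Fin n → ℝ) (L : ℝ) : Set (Fin n → ℝ) :=
  {y | ∀ i, |y i - x i| ≤ L}

/-- The upper part `R⁺(γ) = Q(x, L) × (t + γ L^p, t + L^p)` of the parabolic rectangle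
`R(x, t, L) = Q(x, L) × (t - L^p, t + L^p)`. -/
def upperPart {n : ℕ} (p γ : ℝ) (x : Fin n → ℝ) (t L : ℝ) : Set (SpaceTime n) :=
  cube x L ×ˢ Set.Ioo (t + γ * L ^ p) (t + L ^ p)

/-- The lower part `R⁻(γ) = Q(x, L) × (t - L^p, t - γ L^p)` of the parabolic rectangle
`R(x, t, L) = Q(x, L) × (t - L^p, t + L^p)`. -/
def lowerPart {n : ℕ} (p γ : ℝ) (x : Fin n → ℝ) (t L : ℝ) : Set (SpaceTime n) :=
  cube x L ×ˢ Set.Ioo (t - L ^ p) (t - γ * L ^ p)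

/-- The uncentered forward in time parabolic maximal function `M^{γ+} f`: the supremum of the
averages of `|f|` over `R⁺(γ)`, over all parabolic rectangles `R` with `(x, t) ∈ R⁻(γ)`. -/
def forwardMaximal {n : ℕ} (p γ : ℝ) (f : SpaceTime n → ℝ) (z : SpaceTime n) : ℝ≥0∞ :=
  ⨆ (x : Fin n → ℝ) (t : ℝ) (L : ℝ) (_ : 0 < L) (_ : z ∈ lowerPart p γ x t L),
    ⨍⁻ y in upperPart p γ x t L, ‖f y‖ₑ ∂volume

/-- A weight is a nonnegative locally integrable function. -/
def IsWeight {n : ℕ} (w : SpaceTime n → ℝ) : Prop :=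
  (∀ z, 0 ≤ w z) ∧ LocallyIntegrable w

/-- The constant `[w]` of the parabolic Muckenhoupt class `A_q^+(γ)`. All quantities are
`[0, ∞]`-valued: `w^{1/(1-q)}` is `∞` where `w` vanishes, and `0 * ∞ = 0`. -/
def muckenhouptConst {n : ℕ} (p q γ : ℝ) (w : SpaceTime n → ℝ) : ℝ≥0∞ :=
  ⨆ (x : Fin n → ℝ) (t : ℝ) (L : ℝ) (_ : 0 < L),
    (⨍⁻ z in lowerPart p γ x t L, ENNReal.ofReal (w z) ∂volume) *
      (⨍⁻ z in upperPart p γ x t L, ENNReal.ofReal (w z) ^ (1 / (1 - q)) ∂volume) ^ (q - 1)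

/-- Membership of the weight `w` in the parabolic Muckenhoupt class `A_q^+(γ)`. -/
def MemMuckenhoupt {n : ℕ} (p q γ : ℝ) (w : SpaceTime n → ℝ) : Prop :=
  muckenhouptConst p q γ w < ∞

/-- The strong type estimate `∫ (M^{γ+} f)^q w ≤ C ∫ |f|^q w` for every locally integrable `f`. -/
def StrongType {n : ℕ} (p q γ : ℝ) (w : SpaceTime n → ℝ) (C : ℝ) : Prop :=
  ∀ f : SpaceTime n → ℝ, LocallyIntegrable f →
    ∫⁻ z, forwardMaximal p γ f z ^ q * ENNReal.ofReal (w z) ≤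
      ENNReal.ofReal C * ∫⁻ z, ‖f z‖ₑ ^ q * ENNReal.ofReal (w z)

end ParabolicWeights

end

/-! Necessity is a test. Apply the estimate to the dual weight σ = w^{1/(1-q)}, regularised by
replacing w with w + ε and cut off to R⁺(γ). One average bounds the maximal function from below on
R⁻(γ), and ε → 0 gives the condition.

Sufficiency is discretised. The grid has boxes of time length 2^{-k} and spatial side 2^{-⌊k/p⌋},
and A_q^+(γ) is traded for conditions w(P) σ(P + v)^{q-1} ≤ C |P|^q on boxes P and translates P + v
of the same generation. If the time component of v dominates the p-th power of its spatial part, P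
and P + v fit into the two parts of one rectangle. By Hölder w(P) ≤ C w(P + v), so admissible shifts
can be added (`ShiftCondition.add`). Cutting a shift into N pieces divides the time lag by N but the
p-th power of the spatial part by N^p. As p > 1, all shifts needed to cover R⁺(γ) from a point of
R⁻(γ) by boxes small against R become admissible (`goodShift_of_large`), and M^{γ+} is dominated by
finitely many dyadic maximal functions with a lag (`exists_forwardMaximal_le`).

The heart is a one-sided A_∞ property of σ: if E ⊆ P and |E| ≲ 2^{-i}|P|, then σ(E) ≤ C θ^i σ(P -
u') with θ < 1 (`exists_dualMeasure_le_pow`). Indeed σ(P) ≤ C σ(S) whenever S fills a quarter of P -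
u. Cover E by stopping boxes whose backward translates are at most half filled by E. Adding these
translates multiplies |E| by at most a constant, while the new part carries a fixed fraction of the
σ-mass (`exists_enlargement`). Iterating up the generations gives the decay.

For the strong type bound, take stopping boxes P on which the mean of g = |f| over P + v is about
2^j. The layer of g at height 2^{j+i} fills only about 2^{-i} of P + v, so Hölder and the decay
bound 2^{jq} w(P) by a geometrically weighted sum of ∫ g^q w over the layers
(`rpow_mul_lintegral_box_le`). For fixed i the layers are disjoint in j, so summing costs a
geometric series. The translates P + v of disjoint boxes may overlap, but large parts of them have
bounded overlap (`mul_measure_box_diff_sparsePart_le`). -/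

namespace ParabolicWeights

/-! ### An anisotropic dyadic grid -/

/-- Indices of the boxes of one generation of the grid. -/
abbrev Idx (n : ℕ) : Type := (Fin n → ℤ) × ℤ

/-- The spatial generation belonging to the temporal generation `k`. -/
noncomputable def spaceLevel (p : ℝ) (k : ℤ) : ℤ := ⌊(k : ℝ) / p⌋

/-- The index of the box of generation `k` that contains `z`. -/
noncomputable def idx {n : ℕ} (p : ℝ) (k : ℤ) (z : SpaceTime n) : Idx n :=
  (fun i => ⌊z.1 i * (2 : ℝ) ^ spaceLevel p k⌋, ⌊z.2 * (2 : ℝ) ^ k⌋)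

/-- The grid box of generation `k` and index `a`. -/
def box {n : ℕ} (p : ℝ) (k : ℤ) (a : Idx n) : Set (SpaceTime n) := {z | idx p k z = a}

/-- The volume of the boxes of generation `k`. -/
noncomputable def boxVol (n : ℕ) (p : ℝ) (k : ℤ) : ℝ≥0∞ :=
  ENNReal.ofReal ((2 : ℝ) ^ (-(n * spaceLevel p k + k)))

/-- The index of the box of generation `k` containing the box of generation `k'` and index `a`. -/
noncomputable def ancestor {n : ℕ} (p : ℝ) (k k' : ℤ) (a : Idx n) : Idx n :=
  (fun i => a.1 i / ((2 ^ (spaceLevel p k' - spaceLevel p k).toNat : ℕ) : ℤ),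
    a.2 / ((2 ^ (k' - k).toNat : ℕ) : ℤ))

/-- All coordinates of the index are at most `j` in absolute value. -/
def Near {n : ℕ} (j : ℤ) (e : Idx n) : Prop := (∀ i, |e.1 i| ≤ j) ∧ |e.2| ≤ j

/-- The finite set of the indices with all coordinates at most `j` in absolute value. -/
noncomputable def indexBall (n : ℕ) (j : ℤ) : Finset (Idx n) :=
  (Fintype.piFinset fun _ => Finset.Icc (-j) j) ×ˢ Finset.Icc (-j) j

section Grid

variable {n : ℕ} {p : ℝ}

theorem mem_box {k : ℤ} {a : Idx n} {z : SpaceTime n} : z ∈ box p k a ↔ idx p k z = a := Iff.rfl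

theorem mem_indexBall {j : ℤ} {e : Idx n} : e ∈ indexBall n j ↔ Near j e := by
  simp [indexBall, Near, abs_le]

theorem Near.mono {j j' : ℤ} (h : j ≤ j') {e : Idx n} (he : Near j e) : Near j' e :=
  ⟨fun i => (he.1 i).trans h, he.2.trans h⟩

theorem Near.add {j j' : ℤ} {e e' : Idx n} (he : Near j e) (he' : Near j' e') :
    Near (j + j') (e + e') :=
  ⟨fun i => (abs_add_le _ _).trans (add_le_add (he.1 i) (he'.1 i)),
    (abs_add_le _ _).trans (add_le_add he.2 he'.2)⟩

theorem Near.neg {j : ℤ} {e : Idx n} (he : Near j e) : Near j (-e) :=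
  ⟨fun i => by simpa using he.1 i, by simpa using he.2⟩

theorem near_zero {j : ℤ} (hj : 0 ≤ j) : Near j (0 : Idx n) :=
  ⟨fun i => by simpa using hj, by simpa using hj⟩

theorem exists_near (e : Idx n) : ∃ j : ℤ, 0 ≤ j ∧ Near j e := by
  refine ⟨(∑ i, |e.1 i|) + |e.2|, by positivity, fun i => ?_, ?_⟩
  · have := Finset.single_le_sum (f := fun i => |e.1 i|) (fun i _ => abs_nonneg _)
      (Finset.mem_univ i)
    have h2 := abs_nonneg e.2
    linarith
  · have : 0 ≤ ∑ i, |e.1 i| := Finset.sum_nonneg fun i _ => abs_nonneg _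
    linarith

/-! ### Comparison of generations -/

theorem spaceLevel_mono (hp : 0 < p) {k k' : ℤ} (h : k ≤ k') :
    spaceLevel p k ≤ spaceLevel p k' := by
  apply Int.floor_le_floor
  have : (k : ℝ) ≤ k' := by exact_mod_cast h
  gcongr

/-- As p ≥ 1, the spatial generation advances no faster than the temporal one. Hence volumes j
generations apart differ by at most 2^{(n+1)j}. -/
theorem spaceLevel_add_le (hp : 1 ≤ p) (k : ℤ) (j : ℕ) :
    spaceLevel p (k + j) ≤ spaceLevel p k + j := by
  unfold spaceLevel
  rw [← Int.floor_add_natCast]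
  apply Int.floor_le_floor
  push_cast
  rw [add_div]
  have : (j : ℝ) / p ≤ j := div_le_self (by positivity) hp
  linarith

theorem spaceLevel_add_one_le (hp : 0 < p) (k : ℤ) {b : ℕ} (hb : p ≤ b) :
    spaceLevel p k + 1 ≤ spaceLevel p (k + b) := by
  unfold spaceLevel
  rw [← Int.floor_add_one]
  apply Int.floor_le_floor
  push_cast
  rw [add_div]
  have : 1 ≤ (b : ℝ) / p := by rwa [le_div_iff₀ hp, one_mul]
  linarith

theorem floor_mul_zpow_of_le (x : ℝ) {s s' : ℤ} (h : s ≤ s') :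
    ⌊x * (2 : ℝ) ^ s⌋ = ⌊x * (2 : ℝ) ^ s'⌋ / ((2 ^ (s' - s).toNat : ℕ) : ℤ) := by
  rw [← Int.floor_div_natCast]
  congr 1
  obtain ⟨m, rfl⟩ := Int.le.dest h
  have : (s + (m : ℤ) - s).toNat = m := by omega
  rw [this, zpow_add₀ (by norm_num)]
  push_cast
  field_simp
  simp

theorem idx_eq_ancestor (hp : 0 < p) {k k' : ℤ} (h : k ≤ k') (z : SpaceTime n) :
    idx p k z = ancestor p k k' (idx p k' z) := by
  unfold idx ancestor
  ext i
  · exact floor_mul_zpow_of_le _ (spaceLevel_mono hp h)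
  · exact floor_mul_zpow_of_le _ h

theorem idx_eq_of_le (hp : 0 < p) {k k' : ℤ} (h : k ≤ k') {z z' : SpaceTime n}
    (hz : idx p k' z = idx p k' z') : idx p k z = idx p k z' := by
  rw [idx_eq_ancestor hp h z, idx_eq_ancestor hp h z', hz]

theorem box_subset_box (hp : 0 < p) {k k' : ℤ} (h : k ≤ k') (z : SpaceTime n) :
    box p k' (idx p k' z) ⊆ box p k (idx p k z) :=
  fun _ hy => idx_eq_of_le hp h hy

theorem abs_ediv_sub_ediv_le {x y j : ℤ} {d : ℕ} (hd : 1 ≤ d) (h : |x - y| ≤ j) :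
    |x / (d : ℤ) - y / (d : ℤ)| ≤ j / d + 1 := by
  have hd' : (0 : ℤ) < d := by exact_mod_cast hd
  have key : ∀ x y : ℤ, x - y ≤ j → x / (d : ℤ) - y / (d : ℤ) ≤ j / d + 1 := by
    intro x y hxy
    have h1 := Int.mul_ediv_add_emod x d
    have h2 := Int.mul_ediv_add_emod y d
    have h3 := Int.mul_ediv_add_emod j d
    have h4 := Int.emod_nonneg x hd'.ne'
    have h5 := Int.emod_lt_of_pos y hd'
    have h6 := Int.emod_lt_of_pos j hd'
    by_contra! hc
    have : (d : ℤ) * (j / d + 2) ≤ d * (x / d - y / d) :=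
      mul_le_mul_of_nonneg_left (by omega) hd'.le
    nlinarith
  rw [abs_le] at h ⊢
  exact ⟨by linarith [key y x (by linarith)], key x y h.2⟩

/-- Coarsening divides indices by a power of two; the rounding costs at most one unit of distance.
-/
theorem near_ancestor {k k' : ℤ} {j : ℤ} (hj : 0 ≤ j) {a b : Idx n} (h : Near j (a - b)) :
    Near (j + 1) (ancestor p k k' a - ancestor p k k' b) := by
  have key : ∀ (x y : ℤ) (m : ℕ), |x - y| ≤ j →
      |x / ((2 ^ m : ℕ) : ℤ) - y / ((2 ^ m : ℕ) : ℤ)| ≤ j + 1 := by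
    intro x y m hxy
    refine (abs_ediv_sub_ediv_le Nat.one_le_two_pow hxy).trans ?_
    have := Int.ediv_le_self ((2 ^ m : ℕ) : ℤ) hj
    linarith
  exact ⟨fun i => key _ _ _ (h.1 i), key _ _ _ h.2⟩

/-- Over b ≥ p generations every side at least doubles. The contraction j ↦ j/2 + 1 keeps the drift
of the iterated enlargement bounded. -/
theorem near_ancestor_half (hp : 0 < p) {k : ℤ} {b : ℕ} (hb : p ≤ b) {j : ℤ} (hj : 0 ≤ j)
    {x y : Idx n} (h : Near j (x - y)) :
    Near (j / 2 + 1) (ancestor p k (k + b) x - ancestor p k (k + b) y) := by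
  have key : ∀ (x y : ℤ) (m : ℕ), 1 ≤ m → |x - y| ≤ j →
      |x / ((2 ^ m : ℕ) : ℤ) - y / ((2 ^ m : ℕ) : ℤ)| ≤ j / 2 + 1 := by
    intro x y m hm hxy
    refine (abs_ediv_sub_ediv_le Nat.one_le_two_pow hxy).trans ?_
    obtain ⟨m, rfl⟩ := Nat.exists_eq_add_of_le' hm
    have h2 : j / ((2 ^ (m + 1) : ℕ) : ℤ) = j / 2 / ((2 ^ m : ℕ) : ℤ) := by
      rw [Int.ediv_ediv_of_nonneg (by norm_num)]
      congr 1
      push_cast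
      ring
    rw [h2]
    have := Int.ediv_le_self ((2 ^ m : ℕ) : ℤ) (a := j / 2) (by omega)
    linarith
  have hb0 : 1 ≤ b := by
    by_contra! hc
    have : b = 0 := by omega
    subst this
    simp at hb
    linarith
  have hs := spaceLevel_add_one_le hp k hb
  exact ⟨fun i => key _ _ _ (by omega) (h.1 i), key _ _ _ (by omega) h.2⟩

/-! ### Measurability, volume and shrinking of boxes -/

theorem measurable_idx (k : ℤ) : Measurable (idx p k : SpaceTime n → Idx n) := by
  unfold idx
  refine Measurable.prodMk (measurable_pi_lambda _ fun i => Int.measurable_floor.comp ?_)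
    (Int.measurable_floor.comp ?_)
  · fun_prop
  · fun_prop

theorem measurable_comp_idx {β : Type*} [MeasurableSpace β] (k : ℤ) (f : Idx n → β) :
    Measurable fun z : SpaceTime n => f (idx p k z) :=
  (Measurable.of_discrete (f := f)).comp (measurable_idx k)

theorem measurableSet_box (k : ℤ) (a : Idx n) : MeasurableSet (box p k a) :=
  measurable_idx k (measurableSet_singleton a)

theorem measurableSet_idx_mem (k : ℤ) (s : Set (Idx n)) :
    MeasurableSet {z : SpaceTime n | idx p k z ∈ s} :=
  measurable_idx k (MeasurableSet.of_discrete (s := s))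

theorem floor_mul_eq_iff {x : ℝ} {s m : ℤ} :
    ⌊x * (2 : ℝ) ^ s⌋ = m ↔ x ∈ Set.Ico (m * (2 : ℝ) ^ (-s)) ((m + 1) * (2 : ℝ) ^ (-s)) := by
  rw [Int.floor_eq_iff, Set.mem_Ico, zpow_neg, ← div_eq_mul_inv, ← div_eq_mul_inv,
    div_le_iff₀ (by positivity), lt_div_iff₀ (by positivity)]

theorem box_eq_prod (k : ℤ) (a : Idx n) :
    box p k a = (Set.univ.pi fun i => Set.Ico (a.1 i * (2 : ℝ) ^ (-spaceLevel p k))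
      ((a.1 i + 1) * (2 : ℝ) ^ (-spaceLevel p k))) ×ˢ
        Set.Ico (a.2 * (2 : ℝ) ^ (-k)) ((a.2 + 1) * (2 : ℝ) ^ (-k)) := by
  ext z
  simp only [mem_box, idx, Prod.ext_iff, funext_iff, Set.mem_prod, Set.mem_pi, Set.mem_univ,
    true_imp_iff, floor_mul_eq_iff]

theorem volume_box (k : ℤ) (a : Idx n) : volume (box p k a) = boxVol n p k := by
  rw [box_eq_prod, Measure.volume_eq_prod, Measure.prod_prod, Real.volume_pi_Ico,
    Real.volume_Ico]
  have h : ∀ (m s : ℤ), ((m : ℝ) + 1) * (2 : ℝ) ^ (-s) - m * (2 : ℝ) ^ (-s) = (2 : ℝ) ^ (-s) := by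
    intro m s; ring
  simp only [h, Finset.prod_const, Finset.card_univ, Fintype.card_fin, boxVol]
  rw [← ENNReal.ofReal_pow (by positivity), ← ENNReal.ofReal_mul (by positivity)]
  congr 1
  rw [← zpow_natCast, ← zpow_mul, ← zpow_add₀ (by norm_num)]
  congr 1
  ring

theorem boxVol_ne_top (k : ℤ) : boxVol n p k ≠ ∞ := ENNReal.ofReal_ne_top

theorem boxVol_pos (k : ℤ) : 0 < boxVol n p k := by
  unfold boxVol
  rw [ENNReal.ofReal_pos]
  positivity

theorem boxVol_ne_zero (k : ℤ) : boxVol n p k ≠ 0 := (boxVol_pos k).ne'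

theorem boxVol_le_mul (hp : 1 ≤ p) (k : ℤ) (j : ℕ) :
    boxVol n p k ≤ 2 ^ ((n + 1) * j) * boxVol n p (k + j) := by
  unfold boxVol
  have h2 : (2 : ℝ≥0∞) = ENNReal.ofReal 2 := by simp
  rw [h2, ← ENNReal.ofReal_pow (by norm_num), ← ENNReal.ofReal_mul (by positivity)]
  apply ENNReal.ofReal_le_ofReal
  rw [← zpow_natCast, ← zpow_add₀ (by norm_num)]
  apply zpow_le_zpow_right₀ (by norm_num)
  have := spaceLevel_add_le hp k j
  push_cast
  nlinarith [mul_le_mul_of_nonneg_left this (Int.natCast_nonneg n)]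

theorem mul_boxVol_le (hp : 0 < p) (k : ℤ) (j : ℕ) :
    2 ^ j * boxVol n p (k + j) ≤ boxVol n p k := by
  unfold boxVol
  have h2 : (2 : ℝ≥0∞) = ENNReal.ofReal 2 := by simp
  rw [h2, ← ENNReal.ofReal_pow (by norm_num), ← ENNReal.ofReal_mul (by positivity)]
  apply ENNReal.ofReal_le_ofReal
  rw [← zpow_natCast, ← zpow_add₀ (by norm_num)]
  apply zpow_le_zpow_right₀ (by norm_num)
  have := spaceLevel_mono hp (show k ≤ k + j by omega)
  nlinarith [mul_le_mul_of_nonneg_left this (Int.natCast_nonneg n)]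

/-- The union of the boxes of generation `k` with index near `a`. -/
def boxNhd (p : ℝ) (j k : ℤ) (a : Idx n) : Set (SpaceTime n) := {z | Near j (idx p k z - a)}

theorem boxNhd_subset (j k : ℤ) (a : Idx n) :
    boxNhd p j k a ⊆ ⋃ e ∈ indexBall n j, box p k (a + e) := by
  intro z hz
  simp only [Set.mem_iUnion, exists_prop]
  exact ⟨idx p k z - a, mem_indexBall.2 hz, by simp [mem_box]⟩

theorem measure_boxNhd_le (μ : Measure (SpaceTime n)) (j k : ℤ) (a : Idx n) :
    μ (boxNhd p j k a) ≤ ∑ e ∈ indexBall n j, μ (box p k (a + e)) :=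
  (measure_mono (boxNhd_subset j k a)).trans (measure_biUnion_finset_le _ _)

theorem volume_boxNhd_le (j k : ℤ) (a : Idx n) :
    volume (boxNhd p j k a) ≤ (indexBall n j).card * boxVol n p k := by
  refine (measure_boxNhd_le volume j k a).trans ?_
  simp [volume_box]

theorem tendsto_zpow_neg_of_tendsto {s : ℤ → ℤ} (hs : Filter.Tendsto s Filter.atTop Filter.atTop) :
    Filter.Tendsto (fun k => (2 : ℝ) ^ (-s k)) Filter.atTop (nhds 0) := by
  have h1 : Filter.Tendsto (fun k : ℤ => Real.exp (Real.log 2 * (s k : ℝ))) Filter.atTop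
      Filter.atTop :=
    Real.tendsto_exp_atTop.comp ((tendsto_intCast_atTop_atTop.comp hs).const_mul_atTop
      (Real.log_pos (by norm_num)))
  refine h1.inv_tendsto_atTop.congr fun k => ?_
  rw [Pi.inv_apply, ← Real.rpow_def_of_pos (by norm_num), Real.rpow_intCast, zpow_neg]

theorem tendsto_spaceLevel (hp : 0 < p) :
    Filter.Tendsto (spaceLevel p) Filter.atTop Filter.atTop := by
  unfold spaceLevel
  refine tendsto_floor_atTop.comp ?_
  exact (tendsto_intCast_atTop_atTop).atTop_div_const hp

theorem exists_box_subset_of_isOpen (hp : 0 < p) {O : Set (SpaceTime n)} (hO : IsOpen O)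
    {z : SpaceTime n} (hz : z ∈ O) : ∃ k₀ : ℤ, ∀ k, k₀ ≤ k → box p k (idx p k z) ⊆ O := by
  obtain ⟨ε, hε, hball⟩ := Metric.isOpen_iff.1 hO z hz
  have h1 := (tendsto_zpow_neg_of_tendsto (tendsto_spaceLevel hp)).eventually (gt_mem_nhds hε)
  have h2 := (tendsto_zpow_neg_of_tendsto Filter.tendsto_id).eventually (gt_mem_nhds hε)
  obtain ⟨k₀, hk₀⟩ := Filter.eventually_atTop.1 (h1.and h2)
  refine ⟨k₀, fun k hk y hy => hball ?_⟩
  obtain ⟨hk1, hk2⟩ := hk₀ k hk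
  have key : ∀ (s m : ℤ) (u v : ℝ), u ∈ Set.Ico (m * (2 : ℝ) ^ (-s)) ((m + 1) * (2 : ℝ) ^ (-s)) →
      v ∈ Set.Ico (m * (2 : ℝ) ^ (-s)) ((m + 1) * (2 : ℝ) ^ (-s)) → dist u v < (2 : ℝ) ^ (-s) := by
    intro s m u v hu hv
    rw [Real.dist_eq, abs_lt]
    constructor <;> nlinarith [hu.1, hu.2, hv.1, hv.2]
  have hzb : z ∈ box p k (idx p k z) := rfl
  rw [box_eq_prod] at hy hzb
  rw [Metric.mem_ball, Prod.dist_eq, max_lt_iff]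
  refine ⟨(dist_pi_lt_iff hε).2 fun i => ?_, ?_⟩
  · exact (key _ _ _ _ (hy.1 i (Set.mem_univ i)) (hzb.1 i (Set.mem_univ i))).trans hk1
  · exact (key _ _ _ _ hy.2 hzb.2).trans hk2

/-! ### Stopping families -/

/-- The boxes of the family are pairwise disjoint. -/
def DisjointFamily (p : ℝ) (F : Set (ℤ × Idx n)) : Prop :=
  F.PairwiseDisjoint fun P => box p P.1 P.2

/-- The boxes of generation at least `κ` that satisfy `D` and have no proper ancestor of
generation at least `κ` that satisfies `D`. -/
def stopping (p : ℝ) (κ : ℤ) (D : ℤ → Idx n → Prop) : Set (ℤ × Idx n) :=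
  {P | κ ≤ P.1 ∧ D P.1 P.2 ∧ ∀ z ∈ box p P.1 P.2, ∀ k, κ ≤ k → k < P.1 → ¬ D k (idx p k z)}

theorem disjointFamily_stopping (κ : ℤ) (D : ℤ → Idx n → Prop) :
    DisjointFamily p (stopping p κ D) := by
  rintro ⟨k, a⟩ hP ⟨k', a'⟩ hP' hne
  refine Set.disjoint_left.2 fun z hz hz' => hne ?_
  simp only [mem_box] at hz hz'
  rcases lt_trichotomy k k' with h | h | h
  · exact absurd (by rw [hz]; exact hP.2.1) (hP'.2.2 z hz' k hP.1 h)
  · subst h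
    rw [← hz, ← hz']
  · exact absurd (by rw [hz']; exact hP'.2.1) (hP.2.2 z hz k' hP'.1 h)

/-- The lower bound `κ` on the generations guarantees that a coarsest box exists. -/
theorem exists_mem_stopping (hp : 0 < p) {κ : ℤ} {D : ℤ → Idx n → Prop} {k : ℤ}
    {z : SpaceTime n} (hk : κ ≤ k) (hD : D k (idx p k z)) :
    ∃ k', κ ≤ k' ∧ (k', idx p k' z) ∈ stopping p κ D := by
  obtain ⟨k', ⟨hk1, hk2⟩, hmin⟩ := Int.exists_least_of_bdd
    (P := fun k => κ ≤ k ∧ D k (idx p k z)) ⟨κ, fun _ h => h.1⟩ ⟨k, hk, hD⟩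
  refine ⟨k', hk1, hk1, hk2, fun y hy l hl hlk hDl => ?_⟩
  rw [idx_eq_of_le hp hlk.le hy] at hDl
  exact absurd (hmin l ⟨hl, hDl⟩) (by omega)

end Grid

end ParabolicWeights

namespace ParabolicWeights

/-! ### Sparseness of the translates of a disjoint family -/

section Sparse

variable {n : ℕ} {p : ℝ}

open Classical in
/-- The number of boxes of `F` of generation at least `k` whose translate by `v` contains `z`. -/
noncomputable def shiftCount (p : ℝ) (F : Set (ℤ × Idx n)) (v : Idx n) (k : ℤ)
    (z : SpaceTime n) : ℝ≥0∞ :=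
  ∑' P : F, (box p P.1.1 (P.1.2 + v)).indicator (fun _ => if k ≤ P.1.1 then 1 else 0) z

/-- The part of the translate of `P` by `v` that meets at most `N` translates of boxes of `F`
that are not larger. -/
def sparsePart (p : ℝ) (F : Set (ℤ × Idx n)) (v : Idx n) (N : ℕ) (P : ℤ × Idx n) :
    Set (SpaceTime n) :=
  {z | z ∈ box p P.1 (P.2 + v) ∧ shiftCount p F v P.1 z ≤ N}

variable {F : Set (ℤ × Idx n)} {v : Idx n} {N : ℕ}

theorem sparsePart_subset (P : ℤ × Idx n) : sparsePart p F v N P ⊆ box p P.1 (P.2 + v) :=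
  fun _ h => h.1

theorem measurable_shiftCount (k : ℤ) : Measurable (shiftCount p F v k) :=
  Measurable.tsum fun _ =>
    measurable_const.indicator (measurableSet_box _ _)

theorem measurableSet_sparsePart (P : ℤ × Idx n) : MeasurableSet (sparsePart p F v N P) :=
  (measurableSet_box _ _).inter (measurable_shiftCount _ measurableSet_Iic)

/-- Among finitely many boxes whose sparse parts contain z, take the coarsest: its count includes
all the others, and it is at most `N`. -/
theorem tsum_indicator_sparsePart_le (z : SpaceTime n) :
    ∑' P : F, (sparsePart p F v N P.1).indicator (fun _ => (1 : ℝ≥0∞)) z ≤ N := by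
  classical
  rw [ENNReal.tsum_eq_iSup_sum]
  refine iSup_le fun s => ?_
  set s' := s.filter fun P : F => z ∈ sparsePart p F v N P.1 with hs'
  have h1 : ∑ P ∈ s, (sparsePart p F v N P.1).indicator (fun _ => (1 : ℝ≥0∞)) z =
      ∑ P ∈ s', 1 := by
    rw [hs', Finset.sum_filter]
    rfl
  rw [h1]
  rcases s'.eq_empty_or_nonempty with h0 | hne
  · simp [h0]
  · obtain ⟨P₀, hP₀, hmin⟩ := s'.exists_min_image (fun P : F => P.1.1) hne
    have hz : ∀ P ∈ s', z ∈ sparsePart p F v N P.1 := fun P hP => (Finset.mem_filter.1 hP).2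
    refine le_trans ?_ (hz P₀ hP₀).2
    refine le_trans ?_ (ENNReal.sum_le_tsum s')
    refine Finset.sum_le_sum fun P hP => ?_
    rw [Set.indicator_of_mem (hz P hP).1, if_pos (hmin P hP)]

theorem tsum_measure_sparsePart_le (ν : Measure (SpaceTime n)) :
    ∑' P : F, ν (sparsePart p F v N P.1) ≤ N * ν Set.univ := by
  calc ∑' P : F, ν (sparsePart p F v N P.1)
      = ∑' P : F, ∫⁻ z, (sparsePart p F v N P.1).indicator (fun _ => (1 : ℝ≥0∞)) z ∂ν := by
        congr 1 with P
        rw [lintegral_indicator (measurableSet_sparsePart _)]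
        simp
    _ = ∫⁻ z, ∑' P : F, (sparsePart p F v N P.1).indicator (fun _ => (1 : ℝ≥0∞)) z ∂ν := by
        rw [lintegral_tsum]
        exact fun P => (measurable_const.indicator (measurableSet_sparsePart _)).aemeasurable
    _ ≤ ∫⁻ _, N ∂ν := lintegral_mono fun z => tsum_indicator_sparsePart_le z
    _ = N * ν Set.univ := by simp

theorem tsum_measure_sparsePart_inter_le (μ : Measure (SpaceTime n)) {T : Set (SpaceTime n)} :
    ∑' P : F, μ (sparsePart p F v N P.1 ∩ T) ≤ N * μ T := by
  have := tsum_measure_sparsePart_le (p := p) (F := F) (v := v) (N := N) (μ.restrict T)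
  simpa [Measure.restrict_apply (measurableSet_sparsePart _)] using this

theorem box_subset_boxNhd (hp : 0 < p) {j : ℤ} (hj : 0 ≤ j) (hv : Near j v) {k k' : ℤ}
    (hk : k ≤ k') {a a' : Idx n}
    (hne : (box p k a ∩ box p k' (a' + v)).Nonempty) : box p k' a' ⊆ boxNhd p (j + 1) k a := by
  obtain ⟨y, hy, hy'⟩ := hne
  intro z hz
  rw [mem_box] at hy hy' hz
  have h := near_ancestor (p := p) (k := k) (k' := k') (a := idx p k' z) (b := idx p k' y) hj
    (by rw [hz, hy', sub_add_cancel_left]; exact hv.neg)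
  rw [← idx_eq_ancestor hp hk, ← idx_eq_ancestor hp hk, hy] at h
  exact h

/-- Chebyshev's inequality for the counting function on the translate. Its integral only involves
boxes of the family that are not larger and whose translates meet this one. These lie in a
neighbourhood of comparable volume and are disjoint, so their volumes add up to at most a multiple
of the volume of the box. -/
theorem mul_measure_box_diff_sparsePart_le (hp : 0 < p) {j : ℤ} (hj : 0 ≤ j) (hv : Near j v)
    (hF : DisjointFamily p F) {μ : Measure (SpaceTime n)} {Λ : ℝ≥0∞}
    (hμ : ∀ P ∈ F, μ (box p P.1 (P.2 + v)) ≤ Λ * boxVol n p P.1) (P : ℤ × Idx n) :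
    N * μ (box p P.1 (P.2 + v) \ sparsePart p F v N P) ≤
      Λ * ((indexBall n (j + 1)).card * boxVol n p P.1) := by
  set Q := box p P.1 (P.2 + v) with hQ
  calc N * μ (Q \ sparsePart p F v N P)
      ≤ N * (μ.restrict Q) {z | (N : ℝ≥0∞) ≤ shiftCount p F v P.1 z} := by
        refine mul_le_mul_right ((measure_mono ?_).trans (Measure.le_restrict_apply _ _)) _
        rintro z ⟨hz, hz'⟩
        refine ⟨?_, hz⟩
        by_contra hc
        exact hz' ⟨hz, (not_le.1 hc).le⟩
    _ ≤ ∫⁻ z in Q, shiftCount p F v P.1 z ∂μ :=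
        mul_meas_ge_le_lintegral (measurable_shiftCount _) _
    _ = ∑' R : F, ∫⁻ z in Q, (box p R.1.1 (R.1.2 + v)).indicator
          (fun _ => if P.1 ≤ R.1.1 then 1 else 0) z ∂μ := by
        unfold shiftCount
        rw [lintegral_tsum]
        exact fun R => (measurable_const.indicator (measurableSet_box _ _)).aemeasurable
    _ ≤ ∑' R : F, Λ * volume (box p R.1.1 R.1.2 ∩ boxNhd p (j + 1) P.1 (P.2 + v)) := by
        refine ENNReal.tsum_le_tsum fun R => ?_
        rw [lintegral_indicator (measurableSet_box _ _)]
        by_cases hle : P.1 ≤ R.1.1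
        · rw [if_pos hle, setLIntegral_one, Measure.restrict_apply (measurableSet_box _ _)]
          rcases (Q ∩ box p R.1.1 (R.1.2 + v)).eq_empty_or_nonempty with h0 | hne
          · rw [Set.inter_comm, h0]
            simp
          · rw [Set.inter_eq_left.2 (box_subset_boxNhd hp hj hv hle hne), volume_box]
            exact (measure_mono Set.inter_subset_left).trans (hμ R.1 R.2)
        · simp [hle]
    _ = Λ * ∑' R : F, volume (box p R.1.1 R.1.2 ∩ boxNhd p (j + 1) P.1 (P.2 + v)) :=
        ENNReal.tsum_mul_left
    _ ≤ Λ * volume (boxNhd p (j + 1) P.1 (P.2 + v)) := by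
        gcongr
        have hm : MeasurableSet (boxNhd p (j + 1) P.1 (P.2 + v)) :=
          measurableSet_idx_mem (p := p) P.1 {b | Near (j + 1) (b - (P.2 + v))}
        rw [← measure_iUnion]
        · exact measure_mono (Set.iUnion_subset fun R => Set.inter_subset_right)
        · intro R R' hne
          exact (hF R.2 R'.2 (fun h => hne (Subtype.ext h))).mono Set.inter_subset_left
            Set.inter_subset_left
        · exact fun R => (measurableSet_box _ _).inter hm
    _ ≤ Λ * ((indexBall n (j + 1)).card * boxVol n p P.1) := by
        gcongr
        exact volume_boxNhd_le _ _ _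

/-- A disjoint family of boxes whose translates by `v` contain a fixed proportion of `E` has total
volume at most a constant times that of `E`. -/
theorem exists_tsum_boxVol_le (n : ℕ) (hp : 0 < p) {j : ℤ} (hj : 0 ≤ j) {ε : ℝ≥0∞} (hε : ε ≠ 0)
    (hε' : ε ≠ ∞) :
    ∃ C : ℝ≥0∞, C ≠ ∞ ∧ ∀ (F : Set (ℤ × Idx n)), DisjointFamily p F → ∀ v : Idx n, Near j v →
      ∀ E : Set (SpaceTime n), (∀ P ∈ F, ε * boxVol n p P.1 < volume (box p P.1 (P.2 + v) ∩ E)) →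
        ∑' P : F, boxVol n p P.1.1 ≤ C * volume E := by
  obtain ⟨c, hc⟩ : ∃ c : ℝ≥0∞, c = ((indexBall n (j + 1)).card : ℝ≥0∞) := ⟨_, rfl⟩
  have hcε : c / (ε / 2) ≠ ∞ := by
    refine ENNReal.div_ne_top (by simp [hc]) (by simpa using hε)
  -- With `N` > c / (ε/2) the discarded part has at most ε/2 of the volume, so the sparse part keeps
  -- at least the proportion ε/2 of `E`.
  obtain ⟨N, hN⟩ := ENNReal.exists_nat_gt hcε
  have hN0 : (N : ℝ≥0∞) ≠ 0 := (lt_of_le_of_lt (zero_le) hN).ne'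
  have hε2 : ε / 2 ≠ 0 := by simpa using hε
  refine ⟨(ε / 2)⁻¹ * N, ENNReal.mul_ne_top (ENNReal.inv_ne_top.2 hε2) (by simp), ?_⟩
  intro F hF v hv E hE
  have hsp : ∀ P ∈ F, ε / 2 * boxVol n p P.1 ≤ volume (sparsePart p F v N P ∩ E) := by
    intro P hP
    have h1 := mul_measure_box_diff_sparsePart_le (N := N) (μ := volume) (Λ := 1) hp hj hv hF
      (fun P _ => by rw [volume_box, one_mul]) P
    rw [one_mul] at h1
    have h2 : volume (box p P.1 (P.2 + v) \ sparsePart p F v N P) ≤ ε / 2 * boxVol n p P.1 := by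
      rw [← ENNReal.mul_le_mul_iff_right hN0 (by simp)]
      refine h1.trans ?_
      rw [← mul_assoc, ← hc]
      gcongr
      rw [ENNReal.div_lt_iff (Or.inl (by simpa using hε))
        (Or.inl (ENNReal.div_ne_top hε' (by simp)))] at hN
      exact hN.le
    have h3 : ε * boxVol n p P.1 ≤ ε / 2 * boxVol n p P.1 + volume (sparsePart p F v N P ∩ E) := by
      refine (hE P hP).le.trans ?_
      refine le_trans ?_ (add_le_add h2 le_rfl)
      refine (measure_mono ?_).trans (measure_union_le _ _)
      rintro z ⟨hz, hzE⟩
      by_cases h : z ∈ sparsePart p F v N P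
      · exact Or.inr ⟨h, hzE⟩
      · exact Or.inl ⟨hz, h⟩
    rw [← ENNReal.add_halves ε, add_mul, ENNReal.add_halves] at h3
    exact (ENNReal.add_le_add_iff_left (ENNReal.mul_ne_top (ENNReal.div_ne_top hε' (by simp))
      (boxVol_ne_top _))).1 h3
  calc ∑' P : F, boxVol n p P.1.1
      = (ε / 2)⁻¹ * ∑' P : F, ε / 2 * boxVol n p P.1.1 := by
        rw [ENNReal.tsum_mul_left, ← mul_assoc, ENNReal.inv_mul_cancel hε2
          (ENNReal.div_ne_top hε' (by simp)), one_mul]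
    _ ≤ (ε / 2)⁻¹ * ∑' P : F, volume (sparsePart p F v N P.1 ∩ E) := by
        gcongr with P
        exact hsp P.1 P.2
    _ ≤ (ε / 2)⁻¹ * (N * volume E) := by
        gcongr
        exact tsum_measure_sparsePart_inter_le volume
    _ = _ := by rw [mul_assoc]

end Sparse

end ParabolicWeights

namespace ParabolicWeights

/-! ### Enlarging sets backwards in time -/

section Enlarge

variable {n : ℕ} {p : ℝ}

/-- The set is a union of grid boxes of arbitrarily small size. -/
def DyadicOpen (p : ℝ) (E : Set (SpaceTime n)) : Prop :=
  ∀ z ∈ E, ∃ k₀ : ℤ, ∀ k, k₀ ≤ k → box p k (idx p k z) ⊆ E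

theorem DyadicOpen.inter {E E' : Set (SpaceTime n)} (h : DyadicOpen p E) (h' : DyadicOpen p E') :
    DyadicOpen p (E ∩ E') := fun z hz => by
  obtain ⟨k, hk⟩ := h z hz.1
  obtain ⟨k', hk'⟩ := h' z hz.2
  exact ⟨max k k', fun l hl => Set.subset_inter (hk l (le_trans (le_max_left _ _) hl))
    (hk' l (le_trans (le_max_right _ _) hl))⟩

theorem DyadicOpen.union {E E' : Set (SpaceTime n)} (h : DyadicOpen p E) (h' : DyadicOpen p E') :
    DyadicOpen p (E ∪ E') := fun z hz => by
  rcases hz with hz | hz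
  · obtain ⟨k, hk⟩ := h z hz
    exact ⟨k, fun l hl => (hk l hl).trans Set.subset_union_left⟩
  · obtain ⟨k, hk⟩ := h' z hz
    exact ⟨k, fun l hl => (hk l hl).trans Set.subset_union_right⟩

theorem DyadicOpen.iUnion {ι : Sort*} {E : ι → Set (SpaceTime n)} (h : ∀ i, DyadicOpen p (E i)) :
    DyadicOpen p (⋃ i, E i) := fun z hz => by
  obtain ⟨i, hi⟩ := Set.mem_iUnion.1 hz
  obtain ⟨k, hk⟩ := h i z hi
  exact ⟨k, fun l hl => (hk l hl).trans (Set.subset_iUnion E i)⟩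

theorem dyadicOpen_box (hp : 0 < p) (k : ℤ) (a : Idx n) : DyadicOpen p (box p k a) := by
  rintro z rfl
  exact ⟨k, fun l hl => box_subset_box hp hl z⟩

theorem IsOpen.dyadicOpen (hp : 0 < p) {O : Set (SpaceTime n)} (hO : IsOpen O) :
    DyadicOpen p O := fun _ hz => exists_box_subset_of_isOpen hp hO hz

theorem DyadicOpen.measurableSet {E : Set (SpaceTime n)} (h : DyadicOpen p E) :
    MeasurableSet E := by
  have : E = ⋃ P : {P : ℤ × Idx n // box p P.1 P.2 ⊆ E}, box p P.1.1 P.1.2 := by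
    apply Set.Subset.antisymm
    · intro z hz
      obtain ⟨k, hk⟩ := h z hz
      exact Set.mem_iUnion.2 ⟨⟨(k, idx p k z), hk k le_rfl⟩, rfl⟩
    · exact Set.iUnion_subset fun P => P.2
  rw [this]
  exact MeasurableSet.iUnion fun P => measurableSet_box _ _

theorem quarter_le_of_le_add {V s : ℝ≥0∞} (hV : V ≠ ∞) (h : V ≤ V / 4 + V / 2 + s) :
    V / 4 ≤ s := by
  rcases eq_or_ne s ∞ with rfl | hs
  · exact le_top
  have h4 : V / 4 ≠ ∞ := ENNReal.div_ne_top hV (by norm_num)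
  have h2 : V / 2 ≠ ∞ := ENNReal.div_ne_top hV (by norm_num)
  rw [← ENNReal.toReal_le_toReal h4 hs]
  rw [← ENNReal.toReal_le_toReal hV (ENNReal.add_ne_top.2 ⟨ENNReal.add_ne_top.2 ⟨h4, h2⟩, hs⟩),
    ENNReal.toReal_add (ENNReal.add_ne_top.2 ⟨h4, h2⟩) hs, ENNReal.toReal_add h4 h2] at h
  simp only [ENNReal.toReal_div, ENNReal.toReal_ofNat] at h ⊢
  linarith

/-- The measure of a box is controlled by that of large subsets of its translate by `-u`. -/
def ControlledBy (p : ℝ) (u : Idx n) (C : ℝ≥0∞) (ν : Measure (SpaceTime n)) : Prop :=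
  ∀ (k : ℤ) (a : Idx n) (S : Set (SpaceTime n)), MeasurableSet S → S ⊆ box p k (a - u) →
    boxVol n p k / 4 ≤ volume S → ν (box p k a) ≤ C * ν S

/-- A proportion below which a set does not fill boxes. -/
noncomputable def smallRatio (n : ℕ) : ℝ≥0∞ := (2 ^ (n + 2))⁻¹

theorem smallRatio_ne_zero : smallRatio n ≠ 0 := by simp [smallRatio]

theorem smallRatio_ne_top : smallRatio n ≠ ∞ := by simp [smallRatio]

/-- A parent has at most 2^{n+1} times the volume of its child; a set filling at most this
proportion of the parent fills at most half of the child. -/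
theorem smallRatio_mul_boxVol_le (hp : 1 ≤ p) (k : ℤ) :
    smallRatio n * boxVol n p (k - 1) ≤ boxVol n p k / 2 := by
  have h := boxVol_le_mul (n := n) hp (k - 1) 1
  simp only [mul_one, Nat.cast_one, sub_add_cancel] at h
  calc smallRatio n * boxVol n p (k - 1)
      ≤ smallRatio n * (2 ^ (n + 1) * boxVol n p k) := by gcongr
    _ = boxVol n p k / 2 := by
        rw [smallRatio, ← mul_assoc, pow_succ _ (n + 1), ENNReal.mul_inv (by simp) (by simp),
          mul_comm _ (2⁻¹ : ℝ≥0∞), mul_assoc (2⁻¹ : ℝ≥0∞),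
          ENNReal.inv_mul_cancel (by simp) (by simp), mul_one, ENNReal.div_eq_inv_mul]

theorem smallRatio_lt_one : smallRatio n < 1 := by
  rw [smallRatio, ENNReal.inv_lt_one]
  exact one_lt_pow₀ (by norm_num) (by omega)

/-- `E` is covered by stopping boxes P on which it has become dense, and E₁ is `E` together with the
translates P - u. By maximality `E` fills at most half of each translate, so the hypothesis on `ν`
bounds ν(P) by the mass of new points. Bounded overlap of the sparse parts permits summation. Since
`E` is dense near every P, the volumes of the P add up to a multiple of that of `E`. -/
theorem exists_enlargement (n : ℕ) (hp : 1 ≤ p) {j : ℤ} (hj : 0 ≤ j) {u : Idx n} (hu : Near j u)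
    {C₁ : ℝ≥0∞} (hC₁ : C₁ ≠ ∞) :
    ∃ C₂ C₃ : ℝ≥0∞, C₂ ≠ ∞ ∧ C₃ ≠ ∞ ∧ ∀ ν : Measure (SpaceTime n), ControlledBy p u C₁ ν →
      ∀ (κ : ℤ) (E : Set (SpaceTime n)), DyadicOpen p E →
        volume E ≤ smallRatio n * boxVol n p κ →
          ∃ E₁ : Set (SpaceTime n), E ⊆ E₁ ∧ DyadicOpen p E₁ ∧ volume E₁ ≤ C₂ * volume E ∧
            ν E ≤ C₃ * ν (E₁ \ E) ∧ ∀ y ∈ E₁, ∃ z ∈ E, Near (j + 1) (idx p κ y - idx p κ z) := by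
  have hp0 : 0 < p := by linarith
  have hj1 : 0 ≤ j + 1 := by omega
  obtain ⟨C, hC, hCE⟩ := exists_tsum_boxVol_le n hp0 hj1 (smallRatio_ne_zero (n := n))
    smallRatio_ne_top
  obtain ⟨c, hc⟩ : ∃ c : ℕ, c = (indexBall n (j + 1)).card := ⟨_, rfl⟩
  have hc0 : (c : ℝ≥0∞) ≠ 0 := by
    rw [hc]
    exact_mod_cast (Finset.card_pos.2 ⟨0, mem_indexBall.2 (near_zero hj1)⟩).ne'
  refine ⟨1 + c * C, C₁ * (4 * c : ℕ),
    ENNReal.add_ne_top.2 ⟨by simp, ENNReal.mul_ne_top (by simp) hC⟩,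
    ENNReal.mul_ne_top hC₁ (ENNReal.natCast_ne_top _), ?_⟩
  intro ν hν κ E hE hEκ
  have hEm := hE.measurableSet
  -- Density is tested on all near translates and not only on the box itself, so its failure for the
  -- parent of a stopping box also covers the parent of the translate by -u.
  set D : ℤ → Idx n → Prop := fun k a => ∃ e, Near (j + 1) e ∧
    smallRatio n * boxVol n p k < volume (box p k (a + e) ∩ E) with hD
  set F : Set (ℤ × Idx n) := {P | P ∈ stopping p κ D ∧ (box p P.1 P.2 ∩ E).Nonempty} with hF
  have hFd : DisjointFamily p F := (disjointFamily_stopping κ D).subset fun P hP => hP.1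
  -- By the volume bound no box of generation `κ` is selected, so every stopping box has a parent
  -- that was tested.
  have hDκ : ∀ a, ¬ D κ a := by
    rintro a ⟨e, -, he⟩
    exact absurd (he.trans_le (measure_mono Set.inter_subset_right)) (not_lt.2 hEκ)
  -- the box of generation one less is not in the family, so `E` does not fill the translates
  have hhalf : ∀ P ∈ F, volume (box p P.1 (P.2 + -u) ∩ E) ≤ boxVol n p P.1 / 2 := by
    rintro ⟨k, a⟩ ⟨⟨hk, hDk, hmin⟩, z, hz, hzE⟩
    simp only at hk hDk hmin hz ⊢
    have hlt : κ < k := lt_of_le_of_ne hk (by rintro rfl; exact hDκ a hDk)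
    have hn := hmin z hz (k - 1) (by omega) (by omega)
    simp only [hD, not_exists, not_and, not_lt] at hn
    have hsub : box p k (a + -u) ⊆ box p (k - 1) (idx p (k - 1) z +
        (ancestor p (k - 1) k (a + -u) - ancestor p (k - 1) k a)) := by
      intro y hy
      rw [mem_box] at hy hz ⊢
      rw [idx_eq_ancestor hp0 (show k - 1 ≤ k by omega) y,
        idx_eq_ancestor hp0 (show k - 1 ≤ k by omega) z, hy, hz, add_sub_cancel]
    refine (measure_mono (Set.inter_subset_inter_left E hsub)).trans ?_
    refine (hn _ (near_ancestor hj ?_)).trans (smallRatio_mul_boxVol_le hp k)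
    rw [add_sub_cancel_left]
    exact hu.neg
  -- The multiplicity 4c discards at most a quarter of the translate and `E` at most a half, so a
  -- quarter remains.
  have hquarter : ∀ P ∈ F, boxVol n p P.1 / 4 ≤
      volume (sparsePart p F (-u) (4 * c) P \ E) := by
    intro P hP
    have h1 := mul_measure_box_diff_sparsePart_le (N := 4 * c) (μ := volume) (Λ := 1) hp0 hj
      hu.neg hFd (fun P _ => by rw [volume_box, one_mul]) P
    rw [one_mul, ← hc, Nat.cast_mul, mul_comm ((4 : ℕ) : ℝ≥0∞), mul_assoc,
      ENNReal.mul_le_mul_iff_right hc0 (by simp), mul_comm] at h1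
    have h2 : volume (box p P.1 (P.2 + -u) \ sparsePart p F (-u) (4 * c) P) ≤
        boxVol n p P.1 / 4 := by
      rw [ENNReal.le_div_iff_mul_le (by simp) (by simp)]
      exact_mod_cast h1
    refine quarter_le_of_le_add (boxVol_ne_top _) ?_
    calc boxVol n p P.1 = volume (box p P.1 (P.2 + -u)) := (volume_box _ _).symm
      _ ≤ volume ((box p P.1 (P.2 + -u) \ sparsePart p F (-u) (4 * c) P) ∪
            (box p P.1 (P.2 + -u) ∩ E) ∪ (sparsePart p F (-u) (4 * c) P \ E)) := by
          refine measure_mono fun z hz => ?_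
          by_cases hzE : z ∈ E
          · exact Or.inl (Or.inr ⟨hz, hzE⟩)
          · by_cases hzs : z ∈ sparsePart p F (-u) (4 * c) P
            · exact Or.inr ⟨hzs, hzE⟩
            · exact Or.inl (Or.inl ⟨hz, hzs⟩)
      _ ≤ _ := (measure_union_le _ _).trans (add_le_add ((measure_union_le _ _).trans
          (add_le_add h2 (hhalf P hP))) le_rfl)
  have hvol : ∑' P : F, boxVol n p P.1.1 ≤ c * C * volume E := by
    -- The family is sorted by the translate in which `E` is dense; the density lemma applies to
    -- each of the finitely many classes.
    set Fe : Idx n → Set (ℤ × Idx n) := fun e =>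
      {P | P ∈ F ∧ smallRatio n * boxVol n p P.1 < volume (box p P.1 (P.2 + e) ∩ E)} with hFe
    have hsub : F ⊆ ⋃ e ∈ indexBall n (j + 1), Fe e := by
      intro P hP
      obtain ⟨e, he, hPe⟩ := hP.1.2.1
      exact Set.mem_biUnion (mem_indexBall.2 he) ⟨hP, hPe⟩
    calc ∑' P : F, boxVol n p P.1.1
        ≤ ∑' P : (⋃ e ∈ indexBall n (j + 1), Fe e : Set (ℤ × Idx n)), boxVol n p P.1.1 :=
          ENNReal.tsum_mono_subtype (fun P : ℤ × Idx n => boxVol n p P.1) hsub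
      _ ≤ ∑ e ∈ indexBall n (j + 1), ∑' P : Fe e, boxVol n p P.1.1 :=
          ENNReal.tsum_biUnion_le (fun P : ℤ × Idx n => boxVol n p P.1) _ _
      _ ≤ ∑ e ∈ indexBall n (j + 1), C * volume E := by
          refine Finset.sum_le_sum fun e he => hCE (Fe e) (hFd.subset fun P hP => hP.1) e
            (mem_indexBall.1 he) E fun P hP => hP.2
      _ = c * C * volume E := by rw [Finset.sum_const, ← hc, nsmul_eq_mul, mul_assoc]
  refine ⟨E ∪ ⋃ P : F, box p P.1.1 (P.1.2 + -u), Set.subset_union_left,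
    hE.union (DyadicOpen.iUnion fun P => dyadicOpen_box hp0 _ _), ?_, ?_, ?_⟩
  · refine (measure_union_le _ _).trans ?_
    rw [add_mul, one_mul]
    gcongr
    refine (measure_iUnion_le _).trans ?_
    simpa only [volume_box] using hvol
  -- As `E` contains all small boxes around its points and the ratio is below one, stopping occurs
  -- at every point, without a differentiation theorem.
  · have hcover : E ⊆ ⋃ P : F, box p P.1.1 P.1.2 := by
      intro z hz
      obtain ⟨k₀, hk₀⟩ := hE z hz
      have hDz : D (max k₀ κ) (idx p (max k₀ κ) z) := by
        refine ⟨0, near_zero hj1, ?_⟩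
        rw [add_zero, Set.inter_eq_left.2 (hk₀ _ (le_max_left _ _)), volume_box]
        calc smallRatio n * boxVol n p (max k₀ κ) < 1 * boxVol n p (max k₀ κ) :=
              ENNReal.mul_lt_mul_left (boxVol_ne_zero _) (boxVol_ne_top _) smallRatio_lt_one
          _ = _ := one_mul _
      obtain ⟨k', -, hk'⟩ := exists_mem_stopping hp0 (le_max_right _ _) hDz
      exact Set.mem_iUnion.2 ⟨⟨(k', idx p k' z), hk', z, rfl, hz⟩, rfl⟩
    calc ν E ≤ ∑' P : F, ν (box p P.1.1 P.1.2) :=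
          (measure_mono hcover).trans (measure_iUnion_le _)
      _ ≤ ∑' P : F, C₁ * ν (sparsePart p F (-u) (4 * c) P.1 ∩
            ((E ∪ ⋃ P : F, box p P.1.1 (P.1.2 + -u)) \ E)) := by
          refine ENNReal.tsum_le_tsum fun P => ?_
          have hsub : sparsePart p F (-u) (4 * c) P.1 \ E ⊆ box p P.1.1 (P.1.2 - u) := by
            rw [sub_eq_add_neg]
            exact Set.sdiff_subset.trans (sparsePart_subset _)
          refine (hν _ _ _ ((measurableSet_sparsePart _).diff hEm) hsub
            (hquarter P.1 P.2)).trans ?_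
          gcongr
          rintro z ⟨hz, hzE⟩
          exact ⟨hz, Or.inr (Set.mem_iUnion.2 ⟨P, hz.1⟩), hzE⟩
      _ ≤ C₁ * ((4 * c : ℕ) * ν ((E ∪ ⋃ P : F, box p P.1.1 (P.1.2 + -u)) \ E)) := by
          rw [ENNReal.tsum_mul_left]
          gcongr
          exact tsum_measure_sparsePart_inter_le ν
      _ = _ := by rw [mul_assoc]
  · rintro y (hy | hy)
    · exact ⟨y, hy, by rw [sub_self]; exact near_zero hj1⟩
    · obtain ⟨P, hP⟩ := Set.mem_iUnion.1 hy
      obtain ⟨z, hz, hzE⟩ := P.2.2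
      refine ⟨z, hzE, ?_⟩
      rw [mem_box] at hP hz
      rw [idx_eq_ancestor hp0 P.2.1.1 y, idx_eq_ancestor hp0 P.2.1.1 z, hP, hz]
      apply near_ancestor hj
      rw [add_sub_cancel_left]
      exact hu.neg

end Enlarge

end ParabolicWeights

namespace ParabolicWeights

/-! ### Decay of the measure of small sets -/

section Decay

variable {n : ℕ} {p : ℝ}

/-- Each enlargement is followed by a coarsening of b generations, which absorbs both the growth of
the volume and the drift of position, so the same hypotheses hold again. -/
theorem exists_iterated_enlargement (n : ℕ) (hp : 1 ≤ p) {j : ℤ} (hj : 0 ≤ j) {u : Idx n}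
    (hu : Near j u) {C₁ : ℝ≥0∞} (hC₁ : C₁ ≠ ∞) :
    ∃ (b : ℕ) (θ : ℝ≥0∞), 1 ≤ b ∧ θ < 1 ∧ ∀ ν : Measure (SpaceTime n), ControlledBy p u C₁ ν →
      ∀ (m : ℕ) (κ : ℤ) (E : Set (SpaceTime n)), DyadicOpen p E →
        volume E ≤ smallRatio n * boxVol n p (κ + (m * b : ℕ)) →
          ∃ E₁ : Set (SpaceTime n), DyadicOpen p E₁ ∧ volume E₁ ≤ smallRatio n * boxVol n p κ ∧
            ν E ≤ θ ^ m * ν E₁ ∧ ∀ y ∈ E₁, ∃ z ∈ E, Near (j + 3) (idx p κ y - idx p κ z) := by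
  have hp0 : 0 < p := by linarith
  obtain ⟨C₂, C₃, hC₂, hC₃, hstep⟩ := exists_enlargement n hp hj hu hC₁
  obtain ⟨b₁, hb₁⟩ := ENNReal.exists_nat_gt hC₂
  obtain ⟨b₂, hb₂⟩ := exists_nat_ge p
  -- `b₁` makes 2^b exceed the volume growth `C₂`; `b₂` ≥ p makes index distances halve.
  set b := b₁ + b₂ with hb
  have hbp : p ≤ b := by
    push_cast [hb]
    have : (0 : ℝ) ≤ b₁ := by positivity
    linarith
  have hb1 : 1 ≤ b := by exact_mod_cast hp.trans hbp
  have hC₂b : C₂ ≤ 2 ^ b := by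
    refine hb₁.le.trans ?_
    have : b₁ ≤ 2 ^ b := (show b₁ ≤ b by omega).trans Nat.lt_two_pow_self.le
    exact_mod_cast this
  have h1C : 1 + C₃ ≠ 0 := by simp
  have h1C' : 1 + C₃ ≠ ∞ := by simpa using hC₃
  -- Adding C₃ ν(E) to ν(E) ≤ C₃ ν(E₁ \ E) gives (1 + C₃) ν(E) ≤ C₃ ν(E₁).
  refine ⟨b, C₃ / (1 + C₃), hb1, ?_, fun ν hν m => ?_⟩
  · rw [ENNReal.div_lt_iff (Or.inl h1C) (Or.inl h1C'), one_mul, add_comm]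
    exact ENNReal.lt_add_right hC₃ one_ne_zero
  induction m with
  | zero =>
    intro κ E hE hEκ
    refine ⟨E, hE, by simpa using hEκ, by simp, fun y hy => ⟨y, hy, ?_⟩⟩
    rw [sub_self]
    exact near_zero (by omega)
  | succ m ih =>
    intro κ E hE hEκ
    obtain ⟨E₁, hE₁, hvol₁, hν₁, hnear₁⟩ := ih (κ + b) E hE (by
      convert hEκ using 3
      push_cast
      ring)
    obtain ⟨E₂, hsub, hE₂, hvol₂, hν₂, hnear₂⟩ := hstep ν hν (κ + b) E₁ hE₁ hvol₁
    refine ⟨E₂, hE₂, ?_, ?_, ?_⟩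
    · calc volume E₂ ≤ 2 ^ b * (smallRatio n * boxVol n p (κ + b)) :=
            hvol₂.trans (mul_le_mul' hC₂b hvol₁)
        _ = smallRatio n * (2 ^ b * boxVol n p (κ + b)) := by ring
        _ ≤ _ := by gcongr; exact mul_boxVol_le hp0 κ b
    · refine hν₁.trans ?_
      rw [pow_succ, mul_assoc]
      gcongr
      rw [ENNReal.div_eq_inv_mul, mul_assoc, ← ENNReal.div_eq_inv_mul,
        ENNReal.le_div_iff_mul_le (Or.inl h1C) (Or.inl h1C')]
      calc ν E₁ * (1 + C₃) = ν E₁ + C₃ * ν E₁ := by ring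
        _ ≤ C₃ * ν (E₂ \ E₁) + C₃ * ν E₁ := by gcongr
        _ = C₃ * (ν (E₂ \ E₁) + ν E₁) := by ring
        _ = C₃ * ν E₂ := by rw [← measure_sdiff_add_inter E₂ hE₁.measurableSet,
            Set.inter_eq_right.2 hsub]
    · intro y hy
      obtain ⟨y₁, hy₁, hyy₁⟩ := hnear₂ y hy
      obtain ⟨z, hz, hyz⟩ := hnear₁ y₁ hy₁
      refine ⟨z, hz, ?_⟩
      have h := hyy₁.add hyz
      rw [sub_add_sub_cancel] at h
      -- The radius j + 3 is the fixed point: ((j + 1) + (j + 3)) / 2 + 1 = j + 3.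
      have h' := near_ancestor_half (k := κ) hp0 hbp (by omega) h
      rw [← idx_eq_ancestor hp0 (by omega), ← idx_eq_ancestor hp0 (by omega)] at h'
      exact h'.mono (by omega)

/-- A set of relative size 2^{-i} admits about i/d enlargements before reaching the generation of
the box. The final set lies in finitely many neighbouring boxes, all controlled by the single box
shifted back by `u'`. -/
theorem exists_measure_le_pow (n : ℕ) (hp : 1 ≤ p) {j : ℤ} (hj : 0 ≤ j) {u : Idx n}
    (hu : Near j u) {C₁ C₂ : ℝ≥0∞} (hC₁ : C₁ ≠ ∞) (hC₂ : C₂ ≠ ∞) :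
    ∃ C θ : ℝ≥0∞, C ≠ ∞ ∧ θ ≠ 0 ∧ θ < 1 ∧ ∀ (ν : Measure (SpaceTime n)) (u' : Idx n),
      ControlledBy p u C₁ ν →
      (∀ k a e, Near (j + 3) e → ν (box p k (a + e)) ≤ C₂ * ν (box p k (a - u'))) →
      ∀ (i : ℕ) (k : ℤ) (a : Idx n) (E : Set (SpaceTime n)), E ⊆ box p k a →
        2 ^ i * volume E ≤ 8 * boxVol n p k → ν E ≤ C * θ ^ i * ν (box p k (a - u')) := by
  have hp0 : 0 < p := by linarith
  obtain ⟨b, θ₀, hb, hθ₀, hiter⟩ := exists_iterated_enlargement n hp hj hu hC₁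
  obtain ⟨c, hc⟩ : ∃ c : ℕ, c = (indexBall n (j + 3)).card := ⟨_, rfl⟩
  have hc1 : (1 : ℝ≥0∞) ≤ c := by
    rw [hc]
    exact_mod_cast Finset.card_pos.2 ⟨0, mem_indexBall.2 (near_zero (show 0 ≤ j + 3 by omega))⟩
  -- Descending b generations divides the volume by at most 2^d, so `d` steps in i pay for one
  -- enlargement.
  set d := (n + 1) * b with hd
  have hd0 : 0 < d := by positivity
  -- The maximum with 1/2 keeps the rate nonzero, so that it can be inverted.
  set θ₁ := max θ₀ 2⁻¹ with hθ₁
  have hθ₁0 : θ₁ ≠ 0 := (lt_of_lt_of_le (by simp) (le_max_right _ _)).ne'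
  have hθ₁1 : θ₁ < 1 := max_lt hθ₀ (by simp)
  set θ := θ₁ ^ (1 / (d : ℝ)) with hθ
  have hθ0 : θ ≠ 0 := by
    rw [hθ, Ne, ENNReal.rpow_eq_zero_iff]
    rintro (⟨h, -⟩ | ⟨h, -⟩)
    · exact hθ₁0 h
    · exact hθ₁1.ne_top h
  have hθ1 : θ < 1 := ENNReal.rpow_lt_one hθ₁1 (by positivity)
  have hθd : θ ^ d = θ₁ := by
    rw [hθ, ← ENNReal.rpow_natCast, ← ENNReal.rpow_mul, one_div_mul_cancel (by positivity),
      ENNReal.rpow_one]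
  have hθpow : ∀ i : ℕ, θ₀ ^ ((i - (n + 6)) / d) ≤ (θ ^ (d + (n + 6)))⁻¹ * θ ^ i := by
    intro i
    set m := (i - (n + 6)) / d with hm
    have hi : i ≤ d * m + (d + (n + 6)) := by
      have h1 := Nat.div_add_mod (i - (n + 6)) d
      have h2 := Nat.mod_lt (i - (n + 6)) hd0
      rw [← hm] at h1
      omega
    have hpos : θ ^ (d + (n + 6)) ≠ 0 := pow_ne_zero _ hθ0
    have htop : θ ^ (d + (n + 6)) ≠ ∞ := ENNReal.pow_ne_top hθ1.ne_top
    calc θ₀ ^ m ≤ θ₁ ^ m := by gcongr; exact le_max_left _ _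
      _ = (θ ^ (d + (n + 6)))⁻¹ * θ ^ (d * m + (d + (n + 6))) := by
        rw [pow_add _ (d * m), mul_left_comm, ENNReal.inv_mul_cancel hpos htop, mul_one, pow_mul,
          hθd]
      _ ≤ _ := by
        exact mul_le_mul' le_rfl (pow_le_pow_right_of_le_one' hθ1.le hi)
  refine ⟨c * C₂ * (θ ^ (d + (n + 6)))⁻¹, θ, ENNReal.mul_ne_top (ENNReal.mul_ne_top (by simp) hC₂)
    (ENNReal.inv_ne_top.2 (pow_ne_zero _ hθ0)), hθ0, hθ1, ?_⟩
  intro ν u' hν hν' i k a E hE hEi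
  suffices h : ν E ≤ θ₀ ^ ((i - (n + 6)) / d) * (c * C₂ * ν (box p k (a - u'))) by
    calc ν E ≤ θ₀ ^ ((i - (n + 6)) / d) * (c * C₂ * ν (box p k (a - u'))) := h
      _ ≤ (θ ^ (d + (n + 6)))⁻¹ * θ ^ i * (c * C₂ * ν (box p k (a - u'))) := by
        gcongr
        exact hθpow i
      _ = _ := by ring
  rcases lt_or_ge i (n + 6) with hi | hi
  · have : (i - (n + 6)) / d = 0 := by rw [Nat.sub_eq_zero_of_le hi.le, Nat.zero_div]
    rw [this, pow_zero, one_mul]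
    have h0 := hν' k a 0 (near_zero (by omega))
    rw [add_zero] at h0
    refine (measure_mono hE).trans (h0.trans ?_)
    gcongr
    exact le_mul_of_one_le_left' hc1
  · set m := (i - (n + 6)) / d with hm
    have hmi : d * m + (n + 6) ≤ i := by
      have := Nat.mul_div_le (i - (n + 6)) d
      rw [← hm] at this
      omega
    -- In n + 6, three factors of two cancel the 8, n + 2 provide `smallRatio`, and one gives strict
    -- inequality, leaving room for an open superset.
    have hlt : volume E < smallRatio n * boxVol n p (k + (m * b : ℕ)) := by
      have hpow : ∀ l : ℕ, (2 : ℝ≥0∞) ^ l ≠ 0 := fun l => by simp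
      have hpow' : ∀ l : ℕ, (2 : ℝ≥0∞) ^ l ≠ ∞ := fun l => by simp
      have h1 : 2 ^ (d * m) * (2 ^ (n + 6) * volume E) ≤
          2 ^ (d * m) * (8 * boxVol n p (k + (m * b : ℕ))) := by
        calc 2 ^ (d * m) * (2 ^ (n + 6) * volume E) = 2 ^ (d * m + (n + 6)) * volume E := by
              rw [pow_add]; ring
          _ ≤ 2 ^ i * volume E := by
              gcongr
              norm_num
          _ ≤ 8 * boxVol n p k := hEi
          _ ≤ 8 * (2 ^ ((n + 1) * (m * b)) * boxVol n p (k + (m * b : ℕ))) := by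
              gcongr
              exact boxVol_le_mul hp _ _
          _ = _ := by
              rw [show (n + 1) * (m * b) = d * m by rw [hd]; ring]
              ring
      rw [ENNReal.mul_le_mul_iff_right (hpow _) (hpow' _)] at h1
      have h2 : 8 * (2 ^ (n + 3) * volume E) ≤ 8 * boxVol n p (k + (m * b : ℕ)) := by
        refine le_trans (le_of_eq ?_) h1
        rw [show n + 6 = n + 3 + 3 by ring, pow_add _ (n + 3) 3]
        norm_num
        ring
      rw [ENNReal.mul_le_mul_iff_right (by simp) (by simp)] at h2
      rw [smallRatio, ← ENNReal.div_eq_inv_mul, ENNReal.lt_div_iff_mul_lt (by simp) (by simp),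
        mul_comm]
      rcases eq_or_ne (volume E) 0 with h0 | h0
      · rw [h0, mul_zero]
        exact boxVol_pos _
      · refine lt_of_lt_of_le ?_ h2
        refine ENNReal.mul_lt_mul_left h0 ?_ ?_
        · refine ne_top_of_le_ne_top (boxVol_ne_top (n := n) (p := p) k) ?_
          rw [← volume_box k a]
          exact measure_mono hE
        · exact_mod_cast pow_lt_pow_right₀ (one_lt_two : (1 : ℕ) < 2) (show n + 2 < n + 3 by omega)
    obtain ⟨O, hEO, hO, hvolO⟩ := Set.exists_isOpen_lt_of_lt E _ hlt
    obtain ⟨E₁, -, -, hνE₁, hnear⟩ := hiter ν hν m k (O ∩ box p k a)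
      ((IsOpen.dyadicOpen hp0 hO).inter (dyadicOpen_box hp0 k a))
      ((measure_mono Set.inter_subset_left).trans hvolO.le)
    refine (measure_mono (Set.subset_inter hEO hE)).trans (hνE₁.trans ?_)
    gcongr
    have hsub : E₁ ⊆ boxNhd p (j + 3) k a := by
      intro y hy
      obtain ⟨z, hz, hyz⟩ := hnear y hy
      have hz2 := hz.2
      rw [mem_box] at hz2
      rwa [hz2] at hyz
    refine (measure_mono hsub).trans ((measure_boxNhd_le ν _ k a).trans ?_)
    calc ∑ e ∈ indexBall n (j + 3), ν (box p k (a + e))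
        ≤ ∑ e ∈ indexBall n (j + 3), C₂ * ν (box p k (a - u')) :=
          Finset.sum_le_sum fun e he => hν' k a e (mem_indexBall.1 he)
      _ = _ := by rw [Finset.sum_const, ← hc, nsmul_eq_mul, mul_assoc]

end Decay

end ParabolicWeights

namespace ParabolicWeights

/-! ### Two-box conditions for a weight and its dual -/

section Shift

variable {n : ℕ} {p q : ℝ}

/-- Hölder applied to f W^{1/q} and W^{-1/q}. Finiteness of the dual integral forces W ≠ 0 almost
everywhere, so the product is f. -/
theorem rpow_lintegral_le_mul {α : Type*} [MeasurableSpace α] (hq : 1 < q) (μ : Measure α)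
    {W f : α → ℝ≥0∞} (hW : Measurable W) (hWtop : ∀ z, W z ≠ ∞) (hf : Measurable f)
    (hfin : ∫⁻ z, W z ^ (1 / (1 - q)) ∂μ ≠ ∞) :
    (∫⁻ z, f z ∂μ) ^ q ≤ (∫⁻ z, f z ^ q * W z ∂μ) * (∫⁻ z, W z ^ (1 / (1 - q)) ∂μ) ^ (q - 1) := by
  have hq0 : 0 < q := by linarith
  have hq1 : 0 < q - 1 := by linarith
  have hconj : q.HolderConjugate (q / (q - 1)) := Real.HolderConjugate.conjExponent hq
  have hne : ∀ᵐ z ∂μ, W z ≠ 0 := by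
    filter_upwards [ae_lt_top (hW.pow_const _) hfin] with z hz h0
    rw [h0, ENNReal.zero_rpow_of_neg] at hz
    · exact absurd hz (lt_irrefl _)
    · exact div_neg_of_pos_of_neg one_pos (by linarith)
  have h1 : ∫⁻ z, f z ∂μ =
      ∫⁻ z, ((f * fun z => W z ^ (1 / q)) * fun z => W z ^ (-(1 / q))) z ∂μ := by
    refine lintegral_congr_ae ?_
    filter_upwards [hne] with z hz
    rw [Pi.mul_apply, Pi.mul_apply, mul_assoc, ← ENNReal.rpow_add _ _ hz (hWtop z), add_neg_cancel,
      ENNReal.rpow_zero, mul_one]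
  have h2 := ENNReal.lintegral_mul_le_Lp_mul_Lq μ hconj
    (hf.mul (hW.pow_const (1 / q))).aemeasurable (hW.pow_const (-(1 / q))).aemeasurable
  rw [← h1] at h2
  have h3 : ∀ z, (f z * W z ^ (1 / q)) ^ q = f z ^ q * W z := by
    intro z
    rw [ENNReal.mul_rpow_of_nonneg _ _ hq0.le, ← ENNReal.rpow_mul, one_div_mul_cancel hq0.ne',
      ENNReal.rpow_one]
  have h4 : ∀ z, (W z ^ (-(1 / q))) ^ (q / (q - 1)) = W z ^ (1 / (1 - q)) := by
    intro z
    rw [← ENNReal.rpow_mul]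
    congr 1
    have : 1 - q ≠ 0 := by linarith
    field_simp
    ring
  simp only [Pi.mul_apply, h3, h4] at h2
  calc (∫⁻ z, f z ∂μ) ^ q
      ≤ ((∫⁻ z, f z ^ q * W z ∂μ) ^ (1 / q) *
          (∫⁻ z, W z ^ (1 / (1 - q)) ∂μ) ^ (1 / (q / (q - 1)))) ^ q := by
        gcongr
    _ = _ := by
        rw [ENNReal.mul_rpow_of_nonneg _ _ hq0.le, ← ENNReal.rpow_mul, ← ENNReal.rpow_mul,
          one_div_mul_cancel hq0.ne', ENNReal.rpow_one]
        congr 2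
        field_simp

/-- The two-box condition for `W` on the boxes of each generation and their translates by `v`. -/
def ShiftCondition (p q : ℝ) (C : ℝ≥0∞) (v : Idx n) (W : SpaceTime n → ℝ≥0∞) : Prop :=
  ∀ (k : ℤ) (a : Idx n), (∫⁻ z in box p k a, W z) *
    (∫⁻ z in box p k (a + v), W z ^ (1 / (1 - q))) ^ (q - 1) ≤ C * boxVol n p k ^ q

theorem boxVol_rpow_ne_zero (k : ℤ) : boxVol n p k ^ q ≠ 0 := by
  rw [Ne, ENNReal.rpow_eq_zero_iff]
  simp [boxVol_ne_zero, boxVol_ne_top]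

theorem boxVol_rpow_ne_top (hq : 0 ≤ q) (k : ℤ) : boxVol n p k ^ q ≠ ∞ :=
  ENNReal.rpow_ne_top_of_nonneg hq (boxVol_ne_top k)

variable {C : ℝ≥0∞} {v : Idx n} {W : SpaceTime n → ℝ≥0∞}

theorem ShiftCondition.mono {C' : ℝ≥0∞} (h : ShiftCondition p q C v W) (hC : C ≤ C') :
    ShiftCondition p q C' v W := fun k a => (h k a).trans (by gcongr)

theorem ShiftCondition.lintegral_eq_zero (h : ShiftCondition p q C v W) (hq : 1 < q) (hC : C ≠ ∞)
    {k : ℤ} {a : Idx n} (htop : ∫⁻ z in box p k (a + v), W z ^ (1 / (1 - q)) = ∞) :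
    ∫⁻ z in box p k a, W z = 0 := by
  by_contra h0
  have := h k a
  rw [htop, ENNReal.top_rpow_of_pos (by linarith), ENNReal.mul_top h0, top_le_iff] at this
  exact ENNReal.mul_ne_top hC (boxVol_rpow_ne_top (by linarith) k) this

/-- Hölder for the constant 1 on the translate bounds |P|^q by w(P + v) σ(P + v)^{q-1}; multiply by
w(P) and cancel |P|^q. -/
theorem ShiftCondition.lintegral_le (h : ShiftCondition p q C v W) (hq : 1 < q) (hC : C ≠ ∞)
    (hW : Measurable W) (hWtop : ∀ z, W z ≠ ∞) (k : ℤ) (a : Idx n) :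
    ∫⁻ z in box p k a, W z ≤ C * ∫⁻ z in box p k (a + v), W z := by
  rcases eq_or_ne (∫⁻ z in box p k (a + v), W z ^ (1 / (1 - q))) ∞ with htop | htop
  · rw [h.lintegral_eq_zero hq hC htop]
    exact zero_le
  have hH := rpow_lintegral_le_mul hq _ hW hWtop (measurable_const (a := (1 : ℝ≥0∞))) htop
  simp only [lintegral_const, ENNReal.one_rpow, one_mul, Measure.restrict_apply_univ,
    volume_box] at hH
  rw [← ENNReal.mul_le_mul_iff_right (boxVol_rpow_ne_zero (n := n) (p := p) (q := q) k)
    (boxVol_rpow_ne_top (by linarith) k)]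
  calc boxVol n p k ^ q * ∫⁻ z in box p k a, W z
      ≤ ((∫⁻ z in box p k (a + v), W z) *
          (∫⁻ z in box p k (a + v), W z ^ (1 / (1 - q))) ^ (q - 1)) * ∫⁻ z in box p k a, W z := by
        gcongr
    _ = (∫⁻ z in box p k (a + v), W z) * ((∫⁻ z in box p k a, W z) *
          (∫⁻ z in box p k (a + v), W z ^ (1 / (1 - q))) ^ (q - 1)) := by ring
    _ ≤ (∫⁻ z in box p k (a + v), W z) * (C * boxVol n p k ^ q) := by exact mul_le_mul' le_rfl (h k a)
    _ = _ := by ring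

/-- Replace w(P) by C w(P + v), then use the second condition from P + v. This chaining yields lags
that no single rectangle gives. -/
theorem ShiftCondition.add {C' : ℝ≥0∞} {v' : Idx n} (h : ShiftCondition p q C v W)
    (h' : ShiftCondition p q C' v' W) (hq : 1 < q) (hC : C ≠ ∞)
    (hW : Measurable W) (hWtop : ∀ z, W z ≠ ∞) : ShiftCondition p q (C * C') (v + v') W := by
  intro k a
  rw [← add_assoc]
  calc _ ≤ (C * ∫⁻ z in box p k (a + v), W z) *
        (∫⁻ z in box p k (a + v + v'), W z ^ (1 / (1 - q))) ^ (q - 1) := by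
        gcongr
        exact h.lintegral_le hq hC hW hWtop k a
    _ = C * ((∫⁻ z in box p k (a + v), W z) *
        (∫⁻ z in box p k (a + v + v'), W z ^ (1 / (1 - q))) ^ (q - 1)) := by ring
    _ ≤ C * (C' * boxVol n p k ^ q) := by exact mul_le_mul' le_rfl (h' k _)
    _ = _ := by ring

/-- The constant in the comparison of the dual measures of a box and of subsets of its
translates. -/
noncomputable def dualConst (q : ℝ) (C : ℝ≥0∞) : ℝ≥0∞ := 1 + (4 ^ q * C) ^ (1 / (q - 1))

theorem dualConst_ne_top (hq : 1 < q) (hC : C ≠ ∞) : dualConst q C ≠ ∞ := by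
  refine ENNReal.add_ne_top.2 ⟨by simp, ENNReal.rpow_ne_top_of_nonneg ?_ ?_⟩
  · exact one_div_nonneg.2 (by linarith)
  · exact ENNReal.mul_ne_top (ENNReal.rpow_ne_top_of_nonneg (by linarith) (by simp)) hC

/-- Hölder on `S` gives |S|^q ≤ w(S) σ(S)^{q-1}; inserted in the shift condition with w(S) ≤ w(P),
it leaves σ(S) alone on the right. -/
theorem ShiftCondition.dual_le (h : ShiftCondition p q C v W) (hq : 1 < q)
    (hW : Measurable W) (hWtop : ∀ z, W z ≠ ∞) {k : ℤ} {a : Idx n} {S : Set (SpaceTime n)}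
    (hS : S ⊆ box p k a) (hvol : boxVol n p k / 4 ≤ volume S) :
    ∫⁻ z in box p k (a + v), W z ^ (1 / (1 - q)) ≤
      dualConst q C * ∫⁻ z in S, W z ^ (1 / (1 - q)) := by
  have hq1 : 0 < q - 1 := by linarith
  rcases eq_or_ne (∫⁻ z in S, W z ^ (1 / (1 - q))) ∞ with htop | htop
  · rw [htop, ENNReal.mul_top (by simp [dualConst])]
    exact le_top
  have hH := rpow_lintegral_le_mul hq _ hW hWtop (measurable_const (a := (1 : ℝ≥0∞))) htop
  simp only [lintegral_const, ENNReal.one_rpow, one_mul, Measure.restrict_apply_univ] at hH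
  set X := ∫⁻ z in box p k (a + v), W z ^ (1 / (1 - q)) with hX
  set Y := ∫⁻ z in S, W z ^ (1 / (1 - q)) with hY
  have h4 : (boxVol n p k) ^ q ≤ 4 ^ q * volume S ^ q := by
    rw [← ENNReal.mul_rpow_of_nonneg _ _ (by linarith)]
    gcongr
    rw [ENNReal.div_le_iff (by simp) (by simp)] at hvol
    rwa [mul_comm]
  have key : boxVol n p k ^ q * X ^ (q - 1) ≤ boxVol n p k ^ q * (4 ^ q * C * Y ^ (q - 1)) := by
    calc boxVol n p k ^ q * X ^ (q - 1)
        ≤ (4 ^ q * ((∫⁻ z in S, W z) * Y ^ (q - 1))) * X ^ (q - 1) := by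
          gcongr
          exact h4.trans (by gcongr)
      _ ≤ (4 ^ q * ((∫⁻ z in box p k a, W z) * Y ^ (q - 1))) * X ^ (q - 1) := by
          gcongr
      _ = 4 ^ q * Y ^ (q - 1) * ((∫⁻ z in box p k a, W z) * X ^ (q - 1)) := by ring
      _ ≤ 4 ^ q * Y ^ (q - 1) * (C * boxVol n p k ^ q) := by exact mul_le_mul' le_rfl (h k a)
      _ = _ := by ring
  rw [ENNReal.mul_le_mul_iff_right (boxVol_rpow_ne_zero k) (boxVol_rpow_ne_top (by linarith) k)]
    at key
  have key2 := ENNReal.rpow_le_rpow key (one_div_nonneg.2 hq1.le)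
  rw [ENNReal.mul_rpow_of_nonneg _ _ (one_div_nonneg.2 hq1.le), ← ENNReal.rpow_mul,
    ← ENNReal.rpow_mul, mul_one_div_cancel hq1.ne', ENNReal.rpow_one, ENNReal.rpow_one] at key2
  refine key2.trans ?_
  gcongr
  exact le_add_self

/-- The measure with density the dual weight. -/
noncomputable def dualMeasure (q : ℝ) (W : SpaceTime n → ℝ≥0∞) : Measure (SpaceTime n) :=
  volume.withDensity fun z => W z ^ (1 / (1 - q))

theorem dualMeasure_apply (S : Set (SpaceTime n)) :
    dualMeasure q W S = ∫⁻ z in S, W z ^ (1 / (1 - q)) := withDensity_apply' _ _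

theorem ShiftCondition.controlledBy (h : ShiftCondition p q C v W) (hq : 1 < q)
    (hW : Measurable W) (hWtop : ∀ z, W z ≠ ∞) :
    ControlledBy p v (dualConst q C) (dualMeasure q W) := by
  intro k a S _ hSsub hvol
  have := h.dual_le hq hW hWtop hSsub hvol
  rwa [sub_add_cancel, ← dualMeasure_apply, ← dualMeasure_apply] at this

/-- The lags have different roles: `u` drives the enlargements, while `u'` is long enough to look
back from all boxes that the enlarged set can reach. -/
theorem exists_dualMeasure_le_pow (n : ℕ) (hp : 1 ≤ p) (hq : 1 < q) {j : ℤ} (hj : 0 ≤ j)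
    {u : Idx n} (hu : Near j u) (hC : C ≠ ∞) :
    ∃ C' θ : ℝ≥0∞, C' ≠ ∞ ∧ θ ≠ 0 ∧ θ < 1 ∧ ∀ W : SpaceTime n → ℝ≥0∞, Measurable W →
      (∀ z, W z ≠ ∞) → ∀ u' : Idx n, ShiftCondition p q C u W →
      (∀ e, Near (j + 3) e → ShiftCondition p q C (u' + e) W) →
      ∀ (i : ℕ) (k : ℤ) (a : Idx n) (E : Set (SpaceTime n)), E ⊆ box p k a →
        2 ^ i * volume E ≤ 8 * boxVol n p k →
          dualMeasure q W E ≤ C' * θ ^ i * dualMeasure q W (box p k (a - u')) := by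
  obtain ⟨C', θ, hC', hθ0, hθ1, h⟩ := exists_measure_le_pow n hp hj hu
    (dualConst_ne_top hq hC) (dualConst_ne_top hq hC)
  refine ⟨C', θ, hC', hθ0, hθ1, fun W hW hWtop u' hSu hSu' => ?_⟩
  refine h (dualMeasure q W) u' (hSu.controlledBy hq hW hWtop) fun k a e he => ?_
  have := (hSu' e he).dual_le hq hW hWtop (k := k) (a := a - u') subset_rfl
    (by rw [volume_box]; exact ENNReal.div_le_of_le_mul (le_mul_of_one_le_right' (by norm_num)))
  rw [dualMeasure_apply, dualMeasure_apply]
  rwa [show a - u' + (u' + e) = a + e by abel] at this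

end Shift

end ParabolicWeights

namespace ParabolicWeights

/-! ### The strong type estimate for dyadic maximal functions with a time lag -/

section Strong

variable {n : ℕ} {p q : ℝ}

/-- The set where `2 ^ l < g ≤ 2 ^ (l + 1)`. -/
def levelSet (g : SpaceTime n → ℝ≥0∞) (l : ℤ) : Set (SpaceTime n) :=
  {z | (2 : ℝ≥0∞) ^ l < g z ∧ g z ≤ (2 : ℝ≥0∞) ^ (l + 1)}

theorem measurableSet_levelSet {g : SpaceTime n → ℝ≥0∞} (hg : Measurable g) (l : ℤ) :
    MeasurableSet (levelSet g l) :=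
  (measurableSet_lt measurable_const hg).inter (measurableSet_le hg measurable_const)

theorem two_zpow_ne_zero (l : ℤ) : (2 : ℝ≥0∞) ^ l ≠ 0 :=
  (ENNReal.zpow_pos (by simp) (by simp) l).ne'

theorem two_zpow_ne_top (l : ℤ) : (2 : ℝ≥0∞) ^ l ≠ ∞ :=
  (ENNReal.zpow_lt_top (by simp) (by simp) l).ne

theorem two_zpow_add (l m : ℤ) : (2 : ℝ≥0∞) ^ (l + m) = 2 ^ l * 2 ^ m :=
  ENNReal.zpow_add (by simp) (by simp) l m

theorem two_zpow_le {l m : ℤ} (h : l ≤ m) : (2 : ℝ≥0∞) ^ l ≤ 2 ^ m :=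
  ENNReal.zpow_le_of_le (by norm_num) h

theorem exists_mem_levelSet {g : SpaceTime n → ℝ≥0∞} {z : SpaceTime n} (h : g z ≠ ∞) {l : ℤ}
    (hl : (2 : ℝ≥0∞) ^ l < g z) : ∃ i : ℕ, z ∈ levelSet g (l + i) := by
  obtain ⟨m, hm1, hm2⟩ := ENNReal.exists_mem_Ioc_zpow (x := g z) (y := 2)
    (ne_bot_of_gt hl) h (by norm_num) (by simp)
  have hlm : l ≤ m := by
    by_contra! hc
    exact absurd (hl.trans_le (hm2.trans (two_zpow_le (show m + 1 ≤ l by omega)))) (lt_irrefl _)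
  obtain ⟨i, rfl⟩ := Int.le.dest hlm
  exact ⟨i, hm1, hm2⟩

theorem disjoint_levelSet (g : SpaceTime n → ℝ≥0∞) :
    Pairwise (Function.onFun Disjoint (levelSet g)) := by
  have key : ∀ l m : ℤ, l < m → Disjoint (levelSet g l) (levelSet g m) := by
    intro l m h
    refine Set.disjoint_left.2 fun z hz hz' => ?_
    exact absurd (hz'.1.trans_le (hz.2.trans (two_zpow_le (show l + 1 ≤ m by omega)))) (lt_irrefl _)
  intro l m h
  rcases lt_or_gt_of_ne h with h | h
  · exact key l m h
  · exact (key m l h).symm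

theorem pow_rpow_comm (x : ℝ≥0∞) (i : ℕ) (r : ℝ) : (x ^ i) ^ r = (x ^ r) ^ i := by
  rw [← ENNReal.rpow_natCast, ← ENNReal.rpow_mul, mul_comm, ENNReal.rpow_mul,
    ENNReal.rpow_natCast]

theorem tsum_tsum_mul_tsum_comm {ι : Type*} {α : ι → Type*} (A : ℝ≥0∞) (r : ℕ → ℝ≥0∞)
    (y : ∀ j, α j → ℕ → ℝ≥0∞) :
    ∑' j, ∑' P, A * ∑' i, r i * y j P i = A * ∑' i, r i * ∑' j, ∑' P, y j P i := by
  simp_rw [ENNReal.tsum_mul_left]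
  congr 1
  simp_rw [← ENNReal.tsum_mul_left]
  rw [ENNReal.tsum_comm]
  congr 1 with j
  rw [ENNReal.tsum_comm]

/-- A substitute for Hölder on series: each term is τ^i times the supremum of the rescaled terms,
and the power of a supremum is at most the sum of the powers. -/
theorem rpow_tsum_le {q : ℝ} (hq : 0 < q) {τ : ℝ≥0∞} (hτ0 : τ ≠ 0) (hτ1 : τ < 1)
    (x : ℕ → ℝ≥0∞) :
    (∑' i, x i) ^ q ≤ ((1 - τ)⁻¹) ^ q * ∑' i, ((τ ^ i)⁻¹ * x i) ^ q := by
  have h1 : ∑' i, x i ≤ (1 - τ)⁻¹ * ⨆ i, (τ ^ i)⁻¹ * x i := by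
    rw [← ENNReal.tsum_geometric, ← ENNReal.tsum_mul_right]
    refine ENNReal.tsum_le_tsum fun i => ?_
    calc x i = τ ^ i * ((τ ^ i)⁻¹ * x i) := by
          rw [← mul_assoc, ENNReal.mul_inv_cancel (pow_ne_zero _ hτ0)
            (ENNReal.pow_ne_top hτ1.ne_top), one_mul]
      _ ≤ _ := by gcongr; exact le_iSup (fun i => (τ ^ i)⁻¹ * x i) i
  calc (∑' i, x i) ^ q ≤ ((1 - τ)⁻¹ * ⨆ i, (τ ^ i)⁻¹ * x i) ^ q := by gcongr
    _ = ((1 - τ)⁻¹) ^ q * (⨆ i, (τ ^ i)⁻¹ * x i) ^ q := ENNReal.mul_rpow_of_nonneg _ _ hq.le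
    _ = ((1 - τ)⁻¹) ^ q * ⨆ i, ((τ ^ i)⁻¹ * x i) ^ q := by
        congr 1
        exact (ENNReal.orderIsoRpow q hq).map_iSup _
    _ ≤ _ := by
        gcongr
        exact iSup_le fun i => ENNReal.le_tsum i

/-- If the mean of `g` over a large part of the translate of a box is about `2 ^ j`, then the
weight of the box is controlled by the level sets of `g`, with geometric decay. -/
theorem rpow_mul_lintegral_box_le (hq : 1 < q) {C C' θ : ℝ≥0∞} (hC : C ≠ ∞)
    (hC' : C' ≠ ∞) (hθ0 : θ ≠ 0) (hθ1 : θ < 1) {W g : SpaceTime n → ℝ≥0∞} (hW : Measurable W)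
    (hWtop : ∀ z, W z ≠ ∞) (hg : Measurable g) (hgtop : ∀ z, g z ≠ ∞) {u' v : Idx n}
    (hv : ShiftCondition p q C (v - u') W) {k : ℤ} {a : Idx n}
    (hdecay : ∀ (i : ℕ) (E : Set (SpaceTime n)), E ⊆ box p k (a + v) →
        2 ^ i * volume E ≤ 8 * boxVol n p k →
          dualMeasure q W E ≤ C' * θ ^ i * dualMeasure q W (box p k (a + v - u')))
    {j : ℤ} {G : Set (SpaceTime n)} (hGsub : G ⊆ box p k (a + v))
    (hlow : 2 ^ j * boxVol n p k / 2 ≤ ∫⁻ z in G, g z)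
    (hupp : ∫⁻ z in box p k (a + v), g z ≤ 2 ^ (j + 1) * boxVol n p k) :
    ((2 : ℝ≥0∞) ^ j) ^ q * ∫⁻ z in box p k a, W z ≤
      4 ^ q * ((1 - θ ^ ((q - 1) / 2 / q))⁻¹) ^ q * (C' ^ (q - 1) * C) *
        ∑' i : ℕ, (θ ^ ((q - 1) / 2)) ^ i *
          ∫⁻ z in G ∩ levelSet g (j - 2 + i), g z ^ q * W z := by
  have hq0 : 0 < q := by linarith
  have hq1 : 0 < q - 1 := by linarith
  set V := boxVol n p k with hV
  have hVtop : V ≠ ∞ := boxVol_ne_top k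
  have hCV : C * V ^ q ≠ ∞ := ENNReal.mul_ne_top hC (boxVol_rpow_ne_top hq0.le k)
  set B := box p k (a + v - u') with hB
  have hAq : (∫⁻ z in box p k a, W z) * dualMeasure q W B ^ (q - 1) ≤ C * V ^ q := by
    have := hv k a
    rwa [← add_sub_assoc, ← dualMeasure_apply] at this
  -- If w(P) ≠ 0, the shift condition forces the dual measure of `B` to be finite, which the decay
  -- bound needs.
  rcases eq_or_ne (∫⁻ z in box p k a, W z) 0 with hW0 | hW0
  · rw [hW0, mul_zero]
    exact zero_le
  have hBtop : dualMeasure q W B ≠ ∞ := by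
    intro h
    rw [h, ENNReal.top_rpow_of_pos hq1, ENNReal.mul_top hW0, top_le_iff] at hAq
    exact hCV hAq
  set H : ℕ → Set (SpaceTime n) := fun i => G ∩ levelSet g (j - 2 + i) with hH
  have hHsub : ∀ i, H i ⊆ box p k (a + v) := fun i => Set.inter_subset_left.trans hGsub
  set x : ℕ → ℝ≥0∞ := fun i => ∫⁻ z in H i, g z with hx
  set y : ℕ → ℝ≥0∞ := fun i => ∫⁻ z in H i, g z ^ q * W z with hy
  have h8 : (2 : ℝ≥0∞) ^ (j + 1) = 2 ^ (j - 2) * 8 := by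
    rw [show j + 1 = j - 2 + 3 by ring, two_zpow_add]
    norm_num
  have h4 : (2 : ℝ≥0∞) ^ j = 2 ^ (j - 2) * 4 := by
    rw [show j = j - 2 + 2 by ring, two_zpow_add]
    norm_num
  -- the low part of `g` is negligible
  have hsum : 2 ^ j * V ≤ 4 * ∑' i, x i := by
    have h1 : ∫⁻ z in G, g z ≤ 2 ^ (j - 2) * V + ∑' i, x i := by
      have hsub : G ⊆ (G ∩ {z | g z ≤ 2 ^ (j - 2)}) ∪ ⋃ i, H i := by
        intro z hz
        rcases le_or_gt (g z) (2 ^ (j - 2)) with h | h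
        · exact Or.inl ⟨hz, h⟩
        · obtain ⟨i, hi⟩ := exists_mem_levelSet (hgtop z) h
          exact Or.inr (Set.mem_iUnion.2 ⟨i, hz, hi⟩)
      refine (lintegral_mono_set hsub).trans ((lintegral_union_le _ _ _).trans ?_)
      refine add_le_add ?_ (lintegral_iUnion_le _ _)
      calc ∫⁻ z in G ∩ {z | g z ≤ 2 ^ (j - 2)}, g z
          ≤ ∫⁻ _ in G ∩ {z | g z ≤ 2 ^ (j - 2)}, 2 ^ (j - 2) :=
            setLIntegral_mono measurable_const fun z hz => hz.2
        _ = 2 ^ (j - 2) * volume (G ∩ {z | g z ≤ 2 ^ (j - 2)}) := by simp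
        _ ≤ 2 ^ (j - 2) * V := by
            gcongr
            rw [hV, ← volume_box k (a + v)]
            exact measure_mono (Set.inter_subset_left.trans hGsub)
    have h2 := quarter_le_of_le_add (V := 2 ^ j * V) (s := ∑' i, x i)
      (ENNReal.mul_ne_top (two_zpow_ne_top j) hVtop) (by
        calc 2 ^ j * V = 2 ^ j * V / 2 + 2 ^ j * V / 2 := (ENNReal.add_halves _).symm
          _ ≤ (2 ^ (j - 2) * V + ∑' i, x i) + 2 ^ j * V / 2 := by
              gcongr
              exact hlow.trans h1
          _ = 2 ^ (j - 2) * V + 2 ^ j * V / 2 + ∑' i, x i := by ring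
          _ = _ := by
              congr 2
              rw [h4, mul_right_comm, mul_comm _ (4 : ℝ≥0∞), mul_comm (4 : ℝ≥0∞),
                ENNReal.mul_div_cancel_right (by simp) (by simp)])
    rw [ENNReal.div_le_iff (by simp) (by simp)] at h2
    rwa [mul_comm (4 : ℝ≥0∞)]
  -- Chebyshev: g > 2^{j-2+i} on `H i`, while its integral is at most 2^{j+1} V. The quotient is the
  -- 8 of the decay hypothesis.
  have hHvol : ∀ i, 2 ^ i * volume (H i) ≤ 8 * V := by
    intro i
    have h1 : 2 ^ (j - 2 + i) * volume (H i) ≤ 2 ^ (j + 1) * V := by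
      calc 2 ^ (j - 2 + i) * volume (H i) = ∫⁻ _ in H i, 2 ^ (j - 2 + (i : ℤ)) := by simp
        _ ≤ ∫⁻ z in H i, g z := setLIntegral_mono hg fun z hz => hz.2.1.le
        _ ≤ _ := (lintegral_mono_set (hHsub i)).trans hupp
    rw [two_zpow_add, h8, mul_assoc, mul_assoc,
      ENNReal.mul_le_mul_iff_right (two_zpow_ne_zero _) (two_zpow_ne_top _)] at h1
    simpa using h1
  have hterm : ∀ i, x i ^ q * ∫⁻ z in box p k a, W z ≤
      y i * ((θ ^ i) ^ (q - 1) * (C' ^ (q - 1) * C * V ^ q)) := by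
    intro i
    have htop : dualMeasure q W (H i) ≠ ∞ :=
      ne_top_of_le_ne_top (ENNReal.mul_ne_top (ENNReal.mul_ne_top hC'
        (ENNReal.pow_ne_top hθ1.ne_top)) hBtop) (hdecay i (H i) (hHsub i) (hHvol i))
    have hH1 := rpow_lintegral_le_mul hq (volume.restrict (H i)) hW hWtop hg
      (by rwa [← dualMeasure_apply])
    rw [← dualMeasure_apply] at hH1
    calc x i ^ q * ∫⁻ z in box p k a, W z
        ≤ (y i * dualMeasure q W (H i) ^ (q - 1)) * ∫⁻ z in box p k a, W z := by gcongr
      _ ≤ (y i * (C' * θ ^ i * dualMeasure q W B) ^ (q - 1)) * ∫⁻ z in box p k a, W z := by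
          gcongr
          exact hdecay i (H i) (hHsub i) (hHvol i)
      _ = y i * ((θ ^ i) ^ (q - 1) * (C' ^ (q - 1) *
            ((∫⁻ z in box p k a, W z) * dualMeasure q W B ^ (q - 1)))) := by
          rw [ENNReal.mul_rpow_of_nonneg _ _ hq1.le, ENNReal.mul_rpow_of_nonneg _ _ hq1.le]
          ring
      _ ≤ y i * ((θ ^ i) ^ (q - 1) * (C' ^ (q - 1) * (C * V ^ q))) := by gcongr
      _ = _ := by ring
  -- The decay θ^{i(q-1)} is ρ^{2i}: one factor ρ^i pays for summing the layers inside the q-th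
  -- power, the other survives in the conclusion.
  set ρ := θ ^ ((q - 1) / 2) with hρ
  set τ := θ ^ ((q - 1) / 2 / q) with hτ
  have hθtop : θ ≠ ∞ := hθ1.ne_top
  have hρ0 : ρ ≠ 0 := (ENNReal.rpow_pos (pos_iff_ne_zero.2 hθ0) hθtop).ne'
  have hρtop : ρ ≠ ∞ := ENNReal.rpow_ne_top_of_nonneg (by linarith) hθtop
  have hτ0 : τ ≠ 0 := (ENNReal.rpow_pos (pos_iff_ne_zero.2 hθ0) hθtop).ne'
  have hτ1 : τ < 1 := ENNReal.rpow_lt_one hθ1 (by positivity)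
  have hτq : ∀ i : ℕ, ((τ ^ i)⁻¹) ^ q = (ρ ^ i)⁻¹ := by
    intro i
    rw [ENNReal.inv_rpow, pow_rpow_comm, hτ, ← ENNReal.rpow_mul, div_mul_cancel₀ _ hq0.ne']
  have hθq : ∀ i : ℕ, (θ ^ i) ^ (q - 1) = ρ ^ i * ρ ^ i := by
    intro i
    rw [← mul_pow, hρ, ← ENNReal.rpow_add _ _ hθ0 hθtop, add_halves, pow_rpow_comm]
  rw [← ENNReal.mul_le_mul_iff_right (boxVol_rpow_ne_zero (n := n) (p := p) (q := q) k)
    (boxVol_rpow_ne_top hq0.le k), ← hV]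
  calc V ^ q * (((2 : ℝ≥0∞) ^ j) ^ q * ∫⁻ z in box p k a, W z)
      = (2 ^ j * V) ^ q * ∫⁻ z in box p k a, W z := by
        rw [ENNReal.mul_rpow_of_nonneg _ _ hq0.le]
        ring
    _ ≤ (4 * ∑' i, x i) ^ q * ∫⁻ z in box p k a, W z := by gcongr
    _ = 4 ^ q * (∑' i, x i) ^ q * ∫⁻ z in box p k a, W z := by
        rw [ENNReal.mul_rpow_of_nonneg _ _ hq0.le]
    _ ≤ 4 ^ q * (((1 - τ)⁻¹) ^ q * ∑' i, ((τ ^ i)⁻¹ * x i) ^ q) * ∫⁻ z in box p k a, W z := by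
        gcongr
        exact rpow_tsum_le hq0 hτ0 hτ1 x
    _ = 4 ^ q * ((1 - τ)⁻¹) ^ q *
          ∑' i, (ρ ^ i)⁻¹ * (x i ^ q * ∫⁻ z in box p k a, W z) := by
        rw [← mul_assoc, mul_assoc _ (∑' i, _), ← ENNReal.tsum_mul_right]
        congr 2 with i
        rw [ENNReal.mul_rpow_of_nonneg _ _ hq0.le, hτq, mul_assoc]
    _ ≤ 4 ^ q * ((1 - τ)⁻¹) ^ q *
          ∑' i, (C' ^ (q - 1) * C * V ^ q) * (ρ ^ i * y i) := by
        refine mul_le_mul' le_rfl (ENNReal.tsum_le_tsum fun i => ?_)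
        calc (ρ ^ i)⁻¹ * (x i ^ q * ∫⁻ z in box p k a, W z)
            ≤ (ρ ^ i)⁻¹ * (y i * ((θ ^ i) ^ (q - 1) * (C' ^ (q - 1) * C * V ^ q))) := by
              exact mul_le_mul' le_rfl (hterm i)
          _ = ((ρ ^ i)⁻¹ * ρ ^ i) * ((C' ^ (q - 1) * C * V ^ q) * (ρ ^ i * y i)) := by
              rw [hθq]
              ring
          _ = _ := by
              rw [ENNReal.inv_mul_cancel (pow_ne_zero _ hρ0) (ENNReal.pow_ne_top hρtop), one_mul]
    _ = _ := by
        rw [ENNReal.tsum_mul_left]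
        ring

/-- The mean of `g` over the translate by `v` of the box of generation `k` containing `z`. -/
noncomputable def shiftMean (p : ℝ) (v : Idx n) (g : SpaceTime n → ℝ≥0∞) (k : ℤ)
    (a : Idx n) : ℝ≥0∞ :=
  (∫⁻ y in box p k (a + v), g y) / boxVol n p k

/-- The dyadic maximal function with lag `v` over the boxes of generation at least `κ`. -/
noncomputable def dyadicMaximal (p : ℝ) (v : Idx n) (κ : ℤ) (g : SpaceTime n → ℝ≥0∞)
    (z : SpaceTime n) : ℝ≥0∞ :=
  ⨆ (k : ℤ) (_ : κ ≤ k), shiftMean p v g k (idx p k z)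

theorem measurable_dyadicMaximal (v : Idx n) (κ : ℤ) (g : SpaceTime n → ℝ≥0∞) :
    Measurable (dyadicMaximal p v κ g) :=
  Measurable.iSup fun k => Measurable.iSup fun _ => measurable_comp_idx k (shiftMean p v g k)

/-- Each positive mean lies in a unique interval (2^j, 2^{j+1}], and then z lies in a stopping box
for that j. The supremum is thus dominated by the sum over all stopping boxes. -/
theorem dyadicMaximal_rpow_le (hp : 0 < p) (hq : 0 < q) (v : Idx n) (κ : ℤ)
    {g : SpaceTime n → ℝ≥0∞} (hgint : ∀ k (a : Idx n), ∫⁻ z in box p k a, g z ≠ ∞)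
    (z : SpaceTime n) :
    dyadicMaximal p v κ g z ^ q ≤
      ∑' j : ℤ, ∑' P : stopping p κ fun k a => 2 ^ j < shiftMean p v g k a ∧
        shiftMean p v g k a ≤ 2 ^ (j + 1),
        (box p P.1.1 P.1.2).indicator (fun _ => ((2 : ℝ≥0∞) ^ (j + 1)) ^ q) z := by
  rw [dyadicMaximal, ← ENNReal.orderIsoRpow_apply q hq, OrderIso.map_iSup]
  refine iSup_le fun k => ?_
  rw [OrderIso.map_iSup]
  refine iSup_le fun hk => ?_
  rw [ENNReal.orderIsoRpow_apply]
  rcases eq_or_ne (shiftMean p v g k (idx p k z)) 0 with h0 | h0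
  · rw [h0, ENNReal.zero_rpow_of_pos hq]
    exact zero_le
  · have htop : shiftMean p v g k (idx p k z) ≠ ∞ :=
      ENNReal.div_ne_top (hgint _ _) (boxVol_ne_zero k)
    obtain ⟨j, hj1, hj2⟩ := ENNReal.exists_mem_Ioc_zpow (y := 2) h0 htop (by norm_num) (by simp)
    obtain ⟨k', hk', hmem⟩ := exists_mem_stopping (D := fun k a => 2 ^ j < shiftMean p v g k a ∧
        shiftMean p v g k a ≤ 2 ^ (j + 1)) hp hk ⟨hj1, hj2⟩
    refine le_trans ?_ (ENNReal.le_tsum j)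
    refine le_trans ?_ (ENNReal.le_tsum ⟨(k', idx p k' z), hmem⟩)
    rw [Set.indicator_of_mem (show z ∈ box p k' (idx p k' z) from rfl)]
    gcongr

theorem lintegral_tsum_tsum_indicator (F : ℤ → Set (ℤ × Idx n)) (c : ℤ → ℝ≥0∞)
    {W : SpaceTime n → ℝ≥0∞} (hW : Measurable W) :
    ∫⁻ z, ∑' j : ℤ, ∑' P : F j, c j * (box p P.1.1 P.1.2).indicator W z =
      ∑' j : ℤ, ∑' P : F j, c j * ∫⁻ z in box p P.1.1 P.1.2, W z := by
  have hm : ∀ j (P : F j), Measurable fun z => c j * (box p P.1.1 P.1.2).indicator W z :=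
    fun j P => (hW.indicator (measurableSet_box _ _)).const_mul (c j)
  have hm' : ∀ j, Measurable fun z => ∑' P : F j, c j * (box p P.1.1 P.1.2).indicator W z :=
    fun j => Measurable.tsum (hm j)
  rw [lintegral_tsum fun j => (hm' j).aemeasurable]
  congr 1 with j
  rw [lintegral_tsum fun P => (hm j P).aemeasurable]
  congr 1 with P
  rw [lintegral_const_mul _ (hW.indicator (measurableSet_box _ _)),
    lintegral_indicator (measurableSet_box _ _)]

theorem exists_dyadicMaximal_strongType (hp : 1 ≤ p) (hq : 1 < q) {C : ℝ≥0∞} (hC : C ≠ ∞) {j : ℤ}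
    (hj : 0 ≤ j) {u : Idx n} (hu : Near j u) (v : Idx n) :
    ∃ K : ℝ≥0∞, K ≠ ∞ ∧ ∀ W : SpaceTime n → ℝ≥0∞, Measurable W → (∀ z, W z ≠ ∞) →
      ∀ u' : Idx n, ShiftCondition p q C u W →
      (∀ e, Near (j + 3) e → ShiftCondition p q C (u' + e) W) →
      ShiftCondition p q C (v - u') W →
      ∀ g : SpaceTime n → ℝ≥0∞, Measurable g → (∀ z, g z ≠ ∞) →
        (∀ k (a : Idx n), ∫⁻ z in box p k a, g z ≠ ∞) → ∀ κ : ℤ,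
          ∫⁻ z, dyadicMaximal p v κ g z ^ q * W z ≤ K * ∫⁻ z, g z ^ q * W z := by
  have hp0 : 0 < p := by linarith
  have hq0 : 0 < q := by linarith
  have hq1 : 0 < q - 1 := by linarith
  obtain ⟨C', θ, hC', hθ0, hθ1, hdecay⟩ := exists_dualMeasure_le_pow n hp hq hj hu hC
  obtain ⟨jv, hjv, hv⟩ := exists_near v
  obtain ⟨c, hc⟩ : ∃ c : ℕ, c = (indexBall n (jv + 1)).card := ⟨_, rfl⟩
  have hc0 : (c : ℝ≥0∞) ≠ 0 := by
    rw [hc]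
    exact_mod_cast (Finset.card_pos.2 ⟨0, mem_indexBall.2 (near_zero (by omega))⟩).ne'
  set K₀ := 4 ^ q * ((1 - θ ^ ((q - 1) / 2 / q))⁻¹) ^ q * (C' ^ (q - 1) * C) with hK₀
  set ρ := θ ^ ((q - 1) / 2) with hρ
  have hρ1 : ρ < 1 := ENNReal.rpow_lt_one hθ1 (by linarith)
  have hτ1 : θ ^ ((q - 1) / 2 / q) < 1 := ENNReal.rpow_lt_one hθ1 (by positivity)
  have hK₀top : K₀ ≠ ∞ := by
    refine ENNReal.mul_ne_top (ENNReal.mul_ne_top (ENNReal.rpow_ne_top_of_nonneg hq0.le (by simp))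
      (ENNReal.rpow_ne_top_of_nonneg hq0.le (ENNReal.inv_ne_top.2 ?_)))
      (ENNReal.mul_ne_top (ENNReal.rpow_ne_top_of_nonneg hq1.le hC') hC)
    exact (tsub_pos_of_lt hτ1).ne'
  refine ⟨2 ^ q * K₀ * ((1 - ρ)⁻¹ * (4 * c : ℕ)), ?_, ?_⟩
  · refine ENNReal.mul_ne_top (ENNReal.mul_ne_top (ENNReal.rpow_ne_top_of_nonneg hq0.le (by simp))
      hK₀top) (ENNReal.mul_ne_top (ENNReal.inv_ne_top.2 (tsub_pos_of_lt hρ1).ne')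
        (ENNReal.natCast_ne_top _))
  intro W hW hWtop u' hSu hSu' hSv g hg hgtop hgint κ
  set F : ℤ → Set (ℤ × Idx n) := fun j => stopping p κ fun k a => 2 ^ j < shiftMean p v g k a ∧
        shiftMean p v g k a ≤ 2 ^ (j + 1) with hF
  have hFd : ∀ j, DisjointFamily p (F j) := fun j => disjointFamily_stopping κ _
  have hFlow : ∀ j, ∀ P ∈ F j, 2 ^ j * boxVol n p P.1 ≤ ∫⁻ z in box p P.1 (P.2 + v), g z := by
    intro j P hP
    have := hP.2.1.1.le
    rwa [shiftMean, ENNReal.le_div_iff_mul_le (Or.inl (boxVol_ne_zero _))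
      (Or.inl (boxVol_ne_top _))] at this
  have hFupp : ∀ j, ∀ P ∈ F j, ∫⁻ z in box p P.1 (P.2 + v), g z ≤
      2 ^ (j + 1) * boxVol n p P.1 := by
    intro j P hP
    have := hP.2.1.2
    rwa [shiftMean, ENNReal.div_le_iff (boxVol_ne_zero _) (boxVol_ne_top _)] at this
  -- Applied to the measure g dz, the multiplicity 4c discards at most 2^{j-1} |P| of its mass, half
  -- of the lower bound on the translate.
  set E : ℤ → ℤ × Idx n → Set (SpaceTime n) := fun j => sparsePart p (F j) v (4 * c) with hE
  have hElow : ∀ j, ∀ P ∈ F j, 2 ^ j * boxVol n p P.1 / 2 ≤ ∫⁻ z in E j P, g z := by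
    intro j P hP
    have h1 := mul_measure_box_diff_sparsePart_le (N := 4 * c) (μ := volume.withDensity g)
      (Λ := 2 ^ (j + 1)) hp0 hjv hv (hFd j)
      (fun P hP => by rw [withDensity_apply' _ _]; exact hFupp j P hP) P
    rw [withDensity_apply' _ _, ← hc, Nat.cast_mul, two_zpow_add] at h1
    have h2 : ∫⁻ z in box p P.1 (P.2 + v) \ E j P, g z ≤ 2 ^ j * boxVol n p P.1 / 2 := by
      rw [ENNReal.le_div_iff_mul_le (by simp) (by simp)]
      have h3 : (2 * c : ℝ≥0∞) * ((∫⁻ z in box p P.1 (P.2 + v) \ E j P, g z) * 2) ≤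
          (2 * c) * (2 ^ j * boxVol n p P.1) := by
        calc _ = ((4 : ℕ) * c : ℝ≥0∞) * ∫⁻ z in box p P.1 (P.2 + v) \ E j P, g z := by
              push_cast
              rw [show (4 : ℝ≥0∞) = 2 * 2 by norm_num]
              ring
          _ ≤ _ := h1
          _ = _ := by
              rw [zpow_one]
              ring
      rwa [ENNReal.mul_le_mul_iff_right (mul_ne_zero (by simp) hc0)
        (ENNReal.mul_ne_top (by simp) (by simp))] at h3
    have h3 : 2 ^ j * boxVol n p P.1 / 2 + 2 ^ j * boxVol n p P.1 / 2 ≤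
        2 ^ j * boxVol n p P.1 / 2 + ∫⁻ z in E j P, g z := by
      rw [ENNReal.add_halves]
      refine (hFlow j P hP).trans ?_
      have hsub : box p P.1 (P.2 + v) ⊆ (box p P.1 (P.2 + v) \ E j P) ∪ E j P := by
        rw [Set.sdiff_union_self]
        exact Set.subset_union_left
      exact (lintegral_mono_set hsub).trans ((lintegral_union_le _ _ _).trans
        (add_le_add h2 le_rfl))
    exact (ENNReal.add_le_add_iff_left (ENNReal.div_ne_top (ENNReal.mul_ne_top (two_zpow_ne_top _)
      (boxVol_ne_top _)) (by simp))).1 h3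
  have hlocal : ∀ j, ∀ P ∈ F j, ((2 : ℝ≥0∞) ^ j) ^ q * ∫⁻ z in box p P.1 P.2, W z ≤
      K₀ * ∑' i : ℕ, ρ ^ i * ∫⁻ z in E j P ∩ levelSet g (j - 2 + i), g z ^ q * W z :=
    fun j P hP => rpow_mul_lintegral_box_le hq hC hC' hθ0 hθ1 hW hWtop hg hgtop hSv
      (fun i S hS hS' => hdecay W hW hWtop u' hSu hSu' i P.1 (P.2 + v) S hS hS')
      (sparsePart_subset _) (hElow j P hP) (hFupp j P hP)
  set η := volume.withDensity fun z => g z ^ q * W z with hη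
  have hηapp : ∀ S, η S = ∫⁻ z in S, g z ^ q * W z := fun S => withDensity_apply' _ _
  -- For fixed i the level j - 2 + i determines j, so each layer of g is met for one j only, with
  -- overlap at most 4c.
  have hlevels : ∀ i : ℕ, ∑' j : ℤ, ∑' P : F j, η (E j P.1 ∩ levelSet g (j - 2 + i)) ≤
      (4 * c : ℕ) * η Set.univ := by
    intro i
    calc ∑' j : ℤ, ∑' P : F j, η (E j P.1 ∩ levelSet g (j - 2 + i))
        ≤ ∑' j : ℤ, (4 * c : ℕ) * η (levelSet g (j - 2 + i)) :=
          ENNReal.tsum_le_tsum fun j => tsum_measure_sparsePart_inter_le η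
      _ = (4 * c : ℕ) * ∑' j : ℤ, η (levelSet g (j + (i - 2))) := by
          rw [ENNReal.tsum_mul_left]
          congr 3 with j
          congr 2
          ring
      _ = (4 * c : ℕ) * ∑' l : ℤ, η (levelSet g l) := by
          congr 1
          exact (Equiv.addRight ((i : ℤ) - 2)).tsum_eq fun l => η (levelSet g l)
      _ ≤ _ := by
          gcongr
          rw [← measure_iUnion (disjoint_levelSet g) (measurableSet_levelSet hg)]
          exact measure_mono (Set.subset_univ _)
  calc ∫⁻ z, dyadicMaximal p v κ g z ^ q * W z
      ≤ ∫⁻ z, ∑' j : ℤ, ∑' P : F j, ((2 : ℝ≥0∞) ^ (j + 1)) ^ q *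
          (box p P.1.1 P.1.2).indicator W z := by
        refine lintegral_mono fun z => ?_
        calc dyadicMaximal p v κ g z ^ q * W z ≤ _ * W z :=
              mul_le_mul' (dyadicMaximal_rpow_le hp0 hq0 v κ hgint z) le_rfl
          _ = _ := by
            rw [← ENNReal.tsum_mul_right]
            congr 1 with j
            rw [← ENNReal.tsum_mul_right]
            congr 1 with P
            by_cases hz : z ∈ box p P.1.1 P.1.2
            · simp [hz]
            · simp [hz]
    _ = ∑' j : ℤ, ∑' P : F j, ((2 : ℝ≥0∞) ^ (j + 1)) ^ q * ∫⁻ z in box p P.1.1 P.1.2, W z := by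
        exact lintegral_tsum_tsum_indicator F (fun j => ((2 : ℝ≥0∞) ^ (j + 1)) ^ q) hW
    _ ≤ ∑' j : ℤ, ∑' P : F j, 2 ^ q * K₀ * ∑' i : ℕ, ρ ^ i *
          η (E j P.1 ∩ levelSet g (j - 2 + i)) := by
        refine ENNReal.tsum_le_tsum fun j => ENNReal.tsum_le_tsum fun P => ?_
        rw [two_zpow_add, zpow_one, mul_comm _ (2 : ℝ≥0∞), ENNReal.mul_rpow_of_nonneg _ _ hq0.le,
          mul_assoc, mul_assoc]
        simp only [hηapp]
        exact mul_le_mul' le_rfl (hlocal j P.1 P.2)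
    _ = 2 ^ q * K₀ * ∑' i : ℕ, ρ ^ i * ∑' j : ℤ, ∑' P : F j,
          η (E j P.1 ∩ levelSet g (j - 2 + i)) :=
        tsum_tsum_mul_tsum_comm (2 ^ q * K₀) (fun i => ρ ^ i)
          fun j (P : F j) i => η (E j P.1 ∩ levelSet g (j - 2 + i))
    _ ≤ 2 ^ q * K₀ * ∑' i : ℕ, ρ ^ i * ((4 * c : ℕ) * η Set.univ) := by
        gcongr with i
        exact hlevels i
    _ = _ := by
        rw [ENNReal.tsum_mul_right, ENNReal.tsum_geometric, hηapp, setLIntegral_univ]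
        ring

end Strong

end ParabolicWeights

namespace ParabolicWeights

/-! ### From parabolic rectangles to the grid -/

section Rectangles

variable {n : ℕ} {p q γ : ℝ}

/-! ### Size of parabolic rectangles against the grid -/

theorem cube_eq_pi (x : Fin n → ℝ) (L : ℝ) :
    cube x L = Set.univ.pi fun i => Set.Icc (x i - L) (x i + L) := by
  ext y
  simp only [cube, Set.mem_ofPred_eq, Set.mem_pi, Set.mem_univ, true_imp_iff, Set.mem_Icc, abs_le]
  exact forall_congr' fun i => ⟨fun h => ⟨by linarith [h.1], by linarith [h.2]⟩,
    fun h => ⟨by linarith [h.1], by linarith [h.2]⟩⟩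

theorem volume_cube (x : Fin n → ℝ) {L : ℝ} (hL : 0 < L) :
    volume (cube x L) = ENNReal.ofReal ((2 * L) ^ n) := by
  rw [cube_eq_pi, volume_pi, Measure.pi_pi]
  simp only [Real.volume_Icc, add_sub_sub_cancel, Finset.prod_const, Finset.card_univ,
    Fintype.card_fin]
  rw [ENNReal.ofReal_pow (by positivity), two_mul]

theorem volume_upperPart (x : Fin n → ℝ) (t : ℝ) {L : ℝ} (hL : 0 < L) :
    volume (upperPart p γ x t L) = ENNReal.ofReal ((2 * L) ^ n * ((1 - γ) * L ^ p)) := by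
  rw [upperPart, Measure.volume_eq_prod, Measure.prod_prod, volume_cube x hL, Real.volume_Ioo,
    ← ENNReal.ofReal_mul (by positivity)]
  congr 2
  ring

theorem volume_lowerPart (x : Fin n → ℝ) (t : ℝ) {L : ℝ} (hL : 0 < L) :
    volume (lowerPart p γ x t L) = ENNReal.ofReal ((2 * L) ^ n * ((1 - γ) * L ^ p)) := by
  rw [lowerPart, Measure.volume_eq_prod, Measure.prod_prod, volume_cube x hL, Real.volume_Ioo,
    ← ENNReal.ofReal_mul (by positivity)]
  congr 2
  ring

theorem measurableSet_cube (x : Fin n → ℝ) (L : ℝ) : MeasurableSet (cube x L) := by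
  rw [cube_eq_pi]
  exact MeasurableSet.univ_pi fun _ => measurableSet_Icc

theorem measurableSet_upperPart (x : Fin n → ℝ) (t L : ℝ) :
    MeasurableSet (upperPart p γ x t L) :=
  (measurableSet_cube x L).prod measurableSet_Ioo

theorem measurableSet_lowerPart (x : Fin n → ℝ) (t L : ℝ) :
    MeasurableSet (lowerPart p γ x t L) :=
  (measurableSet_cube x L).prod measurableSet_Ioo

theorem rpow_neg_div_le (k : ℤ) :
    (2 : ℝ) ^ (-((k : ℝ) / p)) ≤ (2 : ℝ) ^ (-spaceLevel p k) := by
  rw [← Real.rpow_intCast]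
  apply Real.rpow_le_rpow_of_exponent_le (by norm_num)
  push_cast
  linarith [Int.floor_le ((k : ℝ) / p), show (spaceLevel p k : ℝ) = ⌊(k : ℝ) / p⌋ from rfl]

theorem le_two_mul_rpow_neg_div (k : ℤ) :
    (2 : ℝ) ^ (-spaceLevel p k) ≤ 2 * (2 : ℝ) ^ (-((k : ℝ) / p)) := by
  rw [← Real.rpow_intCast]
  have h : (2 : ℝ) * (2 : ℝ) ^ (-((k : ℝ) / p)) = (2 : ℝ) ^ (1 + -((k : ℝ) / p)) := by
    rw [Real.rpow_add (by norm_num), Real.rpow_one]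
  rw [h]
  apply Real.rpow_le_rpow_of_exponent_le (by norm_num)
  push_cast
  linarith [Int.lt_floor_add_one ((k : ℝ) / p),
    show (spaceLevel p k : ℝ) = ⌊(k : ℝ) / p⌋ from rfl]

theorem mul_zpow_rpow_inv (hp : 0 < p) {Λ : ℝ} (hΛ : 0 ≤ Λ) (k : ℤ) :
    (Λ * (2 : ℝ) ^ (-k)) ^ (1 / p) = Λ ^ (1 / p) * (2 : ℝ) ^ (-((k : ℝ) / p)) := by
  rw [Real.mul_rpow hΛ (by positivity), ← Real.rpow_intCast, ← Real.rpow_mul (by norm_num)]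
  congr 2
  push_cast
  field_simp

/-- The shifts for which a box and its translate fit into the two parts of a parabolic rectangle
of comparable size. -/
def DirectShift (p γ : ℝ) (v : Idx n) : Prop :=
  ∃ Λ : ℝ, ((v.2 : ℝ) + 1) / 2 < Λ ∧ γ * Λ < ((v.2 : ℝ) - 1) / 2 ∧ 0 < Λ ∧
    ∀ i, |(v.1 i : ℝ)| + 1 ≤ Λ ^ (1 / p)

/-- The supremum in the definition of the Muckenhoupt constant is at most `A`. -/
def RectangleCondition (p q γ : ℝ) (A : ℝ≥0∞) (W : SpaceTime n → ℝ≥0∞) : Prop :=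
  ∀ (x : Fin n → ℝ) (t L : ℝ), 0 < L →
    (⨍⁻ z in lowerPart p γ x t L, W z ∂volume) *
      (⨍⁻ z in upperPart p γ x t L, W z ^ (1 / (1 - q)) ∂volume) ^ (q - 1) ≤ A

theorem DirectShift.exists_rectangle (hp : 0 < p) (hγ0 : 0 < γ) (hγ1 : γ < 1) {v : Idx n}
    (hv : DirectShift p γ v) :
    ∃ C : ℝ≥0∞, C ≠ ∞ ∧ ∀ (k : ℤ) (a : Idx n), ∃ (x : Fin n → ℝ) (t L : ℝ), 0 < L ∧
      box p k a ⊆ lowerPart p γ x t L ∧ box p k (a + v) ⊆ upperPart p γ x t L ∧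
      ENNReal.ofReal ((2 * L) ^ n * ((1 - γ) * L ^ p)) ≤ C * boxVol n p k := by
  obtain ⟨Λ, hΛ1, hΛ2, hΛ0, hΛx⟩ := hv
  refine ⟨ENNReal.ofReal ((2 * Λ ^ (1 / p)) ^ n * Λ), ENNReal.ofReal_ne_top, fun k a => ?_⟩
  set s := spaceLevel p k with hs
  set L := (Λ * (2 : ℝ) ^ (-k)) ^ (1 / p) with hL
  have hL0 : 0 < L := by positivity
  have hLp : L ^ p = Λ * (2 : ℝ) ^ (-k) := by
    rw [hL, ← Real.rpow_mul (by positivity), one_div_mul_cancel hp.ne', Real.rpow_one]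
  have hΛp : 0 ≤ Λ ^ (1 / p) := by positivity
  have hLs : L ≤ Λ ^ (1 / p) * (2 : ℝ) ^ (-s) := by
    rw [hL, mul_zpow_rpow_inv hp hΛ0.le]
    exact mul_le_mul_of_nonneg_left (rpow_neg_div_le k) hΛp
  have hsL : Λ ^ (1 / p) * (2 : ℝ) ^ (-s) ≤ 2 * L := by
    rw [hL, mul_zpow_rpow_inv hp hΛ0.le]
    have := mul_le_mul_of_nonneg_left (le_two_mul_rpow_neg_div (p := p) k) hΛp
    linarith
  have hspace : ∀ (m e : ℤ) (y : ℝ), |(e : ℝ)| + 1 ≤ Λ ^ (1 / p) →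
      (y ∈ Set.Ico (m * (2 : ℝ) ^ (-s)) ((m + 1) * (2 : ℝ) ^ (-s)) ∨
        y ∈ Set.Ico (((m + e : ℤ) : ℝ) * (2 : ℝ) ^ (-s))
          ((((m + e : ℤ) : ℝ) + 1) * (2 : ℝ) ^ (-s))) →
      |y - (m + (e + 1) / 2) * (2 : ℝ) ^ (-s)| ≤ L := by
    intro m e y he hy
    have h2s : (0 : ℝ) < (2 : ℝ) ^ (-s) := by positivity
    have h1 := mul_le_mul_of_nonneg_right he h2s.le
    have h2 : (|(e : ℝ)| + 1) * (2 : ℝ) ^ (-s) ≤ 2 * L := h1.trans hsL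
    have h3 := mul_le_mul_of_nonneg_right (le_abs_self (e : ℝ)) h2s.le
    have h4 := mul_le_mul_of_nonneg_right (neg_abs_le (e : ℝ)) h2s.le
    rw [abs_le]
    push_cast at hy
    rcases hy with hy | hy <;> constructor <;> nlinarith [hy.1, hy.2]
  have h2k : (0 : ℝ) < (2 : ℝ) ^ (-k) := by positivity
  -- The rectangle is centred midway between the two boxes. Rounding in the spatial generation loses
  -- a factor two, matched by the half in the spatial distance.
  refine ⟨fun i => (a.1 i + (v.1 i + 1) / 2) * (2 : ℝ) ^ (-s),
    (a.2 + (v.2 + 1) / 2) * (2 : ℝ) ^ (-k), L, hL0, ?_, ?_, ?_⟩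
  · rw [box_eq_prod]
    rintro z ⟨hz1, hz2⟩
    refine ⟨fun i => hspace _ _ _ (hΛx i) (Or.inl (hz1 i (Set.mem_univ i))), ?_⟩
    rw [hLp]
    have h1 := mul_lt_mul_of_pos_right hΛ1 h2k
    have h2 := mul_lt_mul_of_pos_right hΛ2 h2k
    constructor <;> nlinarith [hz2.1, hz2.2]
  · rw [box_eq_prod]
    rintro z ⟨hz1, hz2⟩
    refine ⟨fun i => hspace _ _ _ (hΛx i) (Or.inr (hz1 i (Set.mem_univ i))), ?_⟩
    rw [hLp]
    have h1 := mul_lt_mul_of_pos_right hΛ1 h2k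
    have h2 := mul_lt_mul_of_pos_right hΛ2 h2k
    simp only [Prod.snd_add, Int.cast_add] at hz2
    constructor <;> nlinarith [hz2.1, hz2.2]
  · rw [boxVol, ← ENNReal.ofReal_mul (by positivity)]
    apply ENNReal.ofReal_le_ofReal
    calc (2 * L) ^ n * ((1 - γ) * L ^ p)
        ≤ (2 * (Λ ^ (1 / p) * (2 : ℝ) ^ (-s))) ^ n * (1 * (Λ * (2 : ℝ) ^ (-k))) := by
          rw [hLp]
          gcongr
          linarith
      _ = _ := by
          rw [← mul_assoc 2, mul_pow _ ((2 : ℝ) ^ (-s)), neg_add, zpow_add₀ (by norm_num),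
            ← zpow_natCast ((2 : ℝ) ^ (-s)), ← zpow_mul, neg_mul, mul_comm s, neg_mul_eq_mul_neg]
          ring

/-- The shifts for which the condition on rectangles implies the condition on boxes. -/
def GoodShift (p q γ : ℝ) (v : Idx n) : Prop :=
  ∀ A : ℝ≥0∞, A ≠ ∞ → ∃ C : ℝ≥0∞, C ≠ ∞ ∧ ∀ W : SpaceTime n → ℝ≥0∞, Measurable W →
    (∀ z, W z ≠ ∞) → RectangleCondition p q γ A W → ShiftCondition p q C v W

theorem DirectShift.goodShift (hp : 0 < p) (hq : 1 < q) (hγ0 : 0 < γ) (hγ1 : γ < 1) {v : Idx n}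
    (hv : DirectShift p γ v) : GoodShift p q γ v := by
  intro A hA
  have hq1 : 0 < q - 1 := by linarith
  have hq0 : 0 < q := by linarith
  obtain ⟨C, hC, hrect⟩ := hv.exists_rectangle hp hγ0 hγ1
  refine ⟨A * C ^ q, ENNReal.mul_ne_top hA (ENNReal.rpow_ne_top_of_nonneg hq0.le hC), ?_⟩
  intro W hW hWtop hAW k a
  obtain ⟨x, t, L, hL, hlow, hupp, hvol⟩ := hrect k a
  have h := hAW x t L hL
  rw [setLAverage_eq, setLAverage_eq, volume_lowerPart x t hL, volume_upperPart x t hL] at h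
  set R := ENNReal.ofReal ((2 * L) ^ n * ((1 - γ) * L ^ p)) with hR
  have hR0 : R ≠ 0 := by
    rw [hR, Ne, ENNReal.ofReal_eq_zero, not_le]
    have : 0 < 1 - γ := by linarith
    positivity
  have hRtop : R ≠ ∞ := ENNReal.ofReal_ne_top
  rw [ENNReal.div_rpow_of_nonneg _ _ hq1.le, ENNReal.div_eq_inv_mul, ENNReal.div_eq_inv_mul,
    mul_mul_mul_comm, ← ENNReal.rpow_neg_one, ← ENNReal.rpow_neg, ← ENNReal.rpow_add _ _ hR0 hRtop,
    show -1 + -(q - 1) = -q by ring, ENNReal.rpow_neg, mul_comm, ← div_eq_mul_inv,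
    ENNReal.div_le_iff (by simp [hR0, hRtop, hq0])
      (ENNReal.rpow_ne_top_of_nonneg hq0.le hRtop)] at h
  calc _ ≤ (∫⁻ z in lowerPart p γ x t L, W z) *
        (∫⁻ z in upperPart p γ x t L, W z ^ (1 / (1 - q))) ^ (q - 1) := by gcongr
    _ ≤ A * R ^ q := h
    _ ≤ A * (C * boxVol n p k) ^ q := by gcongr
    _ = _ := by rw [ENNReal.mul_rpow_of_nonneg _ _ hq0.le, mul_assoc]

theorem GoodShift.add (hq : 1 < q) {v v' : Idx n} (hv : GoodShift p q γ v)
    (hv' : GoodShift p q γ v') : GoodShift p q γ (v + v') := by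
  intro A hA
  obtain ⟨C, hC, h⟩ := hv A hA
  obtain ⟨C', hC', h'⟩ := hv' A hA
  exact ⟨C * C', ENNReal.mul_ne_top hC hC', fun W hW hWtop hAW =>
    (h W hW hWtop hAW).add (h' W hW hWtop hAW) hq hC hW hWtop⟩

theorem GoodShift.nsmul_add (hq : 1 < q) {v v' : Idx n} (hv : GoodShift p q γ v)
    (hv' : GoodShift p q γ v') (m : ℕ) : GoodShift p q γ (m • v + v') := by
  induction m with
  | zero => simpa using hv'
  | succ m ih =>
    rw [succ_nsmul', add_assoc]
    exact hv.add hq ih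

theorem exists_uniform_shiftCondition (s : Finset (Idx n)) (hs : ∀ v ∈ s, GoodShift p q γ v)
    {A : ℝ≥0∞} (hA : A ≠ ∞) :
    ∃ C : ℝ≥0∞, C ≠ ∞ ∧ ∀ v ∈ s, ∀ W : SpaceTime n → ℝ≥0∞, Measurable W →
      (∀ z, W z ≠ ∞) → RectangleCondition p q γ A W → ShiftCondition p q C v W := by
  choose! C hC h using fun v hv => hs v hv A hA
  refine ⟨∑ v ∈ s, C v, (ENNReal.sum_lt_top.2 fun v hv => (hC v hv).lt_top).ne, ?_⟩
  intro v hv W hW hWtop hAW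
  exact (h v hv W hW hWtop hAW).mono (Finset.single_le_sum (f := C) (fun _ _ => zero_le) hv)

end Rectangles

end ParabolicWeights

namespace ParabolicWeights

/-! ### The forward maximal function and the dyadic maximal functions -/

section Forward

variable {n : ℕ} {p q γ : ℝ}

theorem lintegral_union_finset_le {α ι : Type*} [MeasurableSpace α] (μ : Measure α) (s : Finset ι)
    (t : ι → Set α) (g : α → ℝ≥0∞) :
    ∫⁻ z in ⋃ i ∈ s, t i, g z ∂μ ≤ ∑ i ∈ s, ∫⁻ z in t i, g z ∂μ := by
  classical
  induction s using Finset.induction_on with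
  | empty => simp
  | insert i s hi ih =>
    rw [Finset.set_biUnion_insert, Finset.sum_insert hi]
    exact (lintegral_union_le _ _ _).trans (add_le_add le_rfl ih)

/-- Cover R⁺(γ) by boxes of a generation that is fine relative to R, as measured by y. From the box
of any z in R⁻(γ) they are reached by finitely many shifts with time lag at least γ y^p - 1 and
spatial part at most 2y + 1, whatever the rectangle. -/
theorem exists_forwardMaximal_le (hp : 0 < p) (hγ0 : 0 < γ) (hγ1 : γ < 1) {y : ℝ} (hy0 : 0 ≤ y)
    (hy : 2 ≤ y ^ p) :
    ∃ s : Finset (Idx n),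
      (∀ v ∈ s, γ * y ^ p - 1 ≤ v.2 ∧ ∀ i, |(v.1 i : ℝ)| ≤ 2 * y + 1) ∧
      ∀ (f : SpaceTime n → ℝ) (g : SpaceTime n → ℝ≥0∞), (fun z => ‖f z‖ₑ) =ᵐ[volume] g →
        ∀ z, forwardMaximal p γ f z ≤ (ENNReal.ofReal (1 - γ))⁻¹ *
          ∑ v ∈ s, ⨆ m : ℕ, dyadicMaximal p v (-(m : ℤ)) g z := by
  classical
  obtain ⟨J, hJ⟩ := exists_int_ge (max (2 * y + 1) (2 * y ^ p + 1))
  have hJ1 : 2 * y + 1 ≤ J := (le_max_left _ _).trans hJ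
  have hJ2 : 2 * y ^ p + 1 ≤ J := (le_max_right _ _).trans hJ
  refine ⟨(indexBall n J).filter fun v => γ * y ^ p - 1 ≤ v.2 ∧ ∀ i, |(v.1 i : ℝ)| ≤ 2 * y + 1,
    fun v hv => (Finset.mem_filter.1 hv).2, ?_⟩
  intro f g hfg z
  refine iSup_le fun x => iSup_le fun t => iSup_le fun L => iSup_le fun hL => iSup_le fun hz => ?_
  have hLp0 : 0 < L ^ p := by positivity
  have hyp : 0 < y ^ p := by linarith
  -- The generation k = -l is fixed by y^p 2^{-k} / 2 ≤ L^p < y^p 2^{-k}.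
  obtain ⟨l, hl1, hl2⟩ := exists_mem_Ico_zpow (x := L ^ p / (y ^ p / 2)) (y := (2 : ℝ))
    (by positivity) (by norm_num)
  set k : ℤ := -l with hk
  have h2k : (0 : ℝ) < (2 : ℝ) ^ (-k) := by positivity
  rw [le_div_iff₀ (by positivity), show l = -k by omega] at hl1
  rw [div_lt_iff₀ (by positivity), show l = -k by omega, zpow_add₀ (by norm_num), zpow_one] at hl2
  have hLup : L ^ p ≤ y ^ p * (2 : ℝ) ^ (-k) := by linarith
  have hLlow : (2 : ℝ) ^ (-k) ≤ L ^ p := by nlinarith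
  have hLy : L ≤ y * (2 : ℝ) ^ (-spaceLevel p k) := by
    have h1 : (L ^ p) ^ (1 / p) ≤ (y ^ p * (2 : ℝ) ^ (-k)) ^ (1 / p) := by gcongr
    rw [mul_zpow_rpow_inv hp hyp.le, ← Real.rpow_mul hL.le, ← Real.rpow_mul hy0,
      mul_one_div_cancel hp.ne', Real.rpow_one, Real.rpow_one] at h1
    exact h1.trans (mul_le_mul_of_nonneg_left (rpow_neg_div_le k) hy0)
  have hL2 : (2 : ℝ) ^ (-spaceLevel p k) ≤ 2 * L := by
    have h1 : (1 * (2 : ℝ) ^ (-k)) ^ (1 / p) ≤ (L ^ p) ^ (1 / p) := by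
      rw [one_mul]
      gcongr
    rw [mul_zpow_rpow_inv hp zero_le_one, ← Real.rpow_mul hL.le, mul_one_div_cancel hp.ne',
      Real.rpow_one, Real.one_rpow, one_mul] at h1
    have := le_two_mul_rpow_neg_div (p := p) k
    linarith
  -- the upper part is covered by the translates
  have hcover : upperPart p γ x t L ⊆
      ⋃ v ∈ (indexBall n J).filter fun v => γ * y ^ p - 1 ≤ v.2 ∧ ∀ i, |(v.1 i : ℝ)| ≤ 2 * y + 1,
        box p k (idx p k z + v) := by
    rintro w ⟨hw1, hw2⟩
    obtain ⟨hz1, hz2⟩ := hz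
    have hspace : ∀ i, |((idx p k w - idx p k z).1 i : ℝ)| ≤ 2 * y + 1 := by
      intro i
      have h2s : (0 : ℝ) < (2 : ℝ) ^ (spaceLevel p k) := by positivity
      have h1 := abs_le.1 (hw1 i)
      have h2 := abs_le.1 (hz1 i)
      have h3 : L * (2 : ℝ) ^ (spaceLevel p k) ≤ y := by
        rw [zpow_neg, ← div_eq_mul_inv, le_div_iff₀ h2s] at hLy
        exact hLy
      have h4 := Int.floor_le (w.1 i * (2 : ℝ) ^ spaceLevel p k)
      have h5 := Int.lt_floor_add_one (w.1 i * (2 : ℝ) ^ spaceLevel p k)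
      have h6 := Int.floor_le (z.1 i * (2 : ℝ) ^ spaceLevel p k)
      have h7 := Int.lt_floor_add_one (z.1 i * (2 : ℝ) ^ spaceLevel p k)
      simp only [idx, Prod.fst_sub, Pi.sub_apply, Int.cast_sub]
      have h8 := mul_le_mul_of_nonneg_right (show w.1 i - z.1 i ≤ 2 * L by linarith) h2s.le
      have h9 := mul_le_mul_of_nonneg_right (show z.1 i - w.1 i ≤ 2 * L by linarith) h2s.le
      rw [abs_le]
      constructor <;> linarith
    have h2k' : (0 : ℝ) < (2 : ℝ) ^ k := by positivity
    have hkk : (2 : ℝ) ^ (-k) * (2 : ℝ) ^ k = 1 := by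
      rw [← zpow_add₀ (by norm_num), neg_add_cancel, zpow_zero]
    have h4 := Int.floor_le (w.2 * (2 : ℝ) ^ k)
    have h5 := Int.lt_floor_add_one (w.2 * (2 : ℝ) ^ k)
    have h6 := Int.floor_le (z.2 * (2 : ℝ) ^ k)
    have h7 := Int.lt_floor_add_one (z.2 * (2 : ℝ) ^ k)
    have hlowt : γ * y ^ p - 1 ≤ ((idx p k w - idx p k z).2 : ℝ) := by
      have h8 := mul_le_mul_of_nonneg_right
        (show γ * (2 * ((2 : ℝ) ^ (-k) * (y ^ p / 2))) ≤ w.2 - z.2 by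
          have := mul_le_mul_of_nonneg_left hl1 hγ0.le
          linarith [hw2.1, hz2.2]) h2k'.le
      have h9 : γ * (2 * ((2 : ℝ) ^ (-k) * (y ^ p / 2))) * (2 : ℝ) ^ k = γ * y ^ p := by
        linear_combination (γ * y ^ p) * hkk
      simp only [idx, Prod.snd_sub, Int.cast_sub]
      linarith
    have huppt : |((idx p k w - idx p k z).2 : ℝ)| ≤ 2 * y ^ p + 1 := by
      have h8 := mul_le_mul_of_nonneg_right
        (show w.2 - z.2 ≤ 2 * (y ^ p * (2 : ℝ) ^ (-k)) by linarith [hw2.2, hz2.1]) h2k'.le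
      have h9 : 2 * (y ^ p * (2 : ℝ) ^ (-k)) * (2 : ℝ) ^ k = 2 * y ^ p := by
        linear_combination (2 * y ^ p) * hkk
      have h10 : 0 < γ * y ^ p := by positivity
      rw [abs_le]
      constructor
      · linarith
      · simp only [idx, Prod.snd_sub, Int.cast_sub]
        linarith
    simp only [Set.mem_iUnion, exists_prop]
    refine ⟨idx p k w - idx p k z, Finset.mem_filter.2 ⟨mem_indexBall.2 ⟨fun i => ?_, ?_⟩,
      hlowt, hspace⟩, by simp [mem_box]⟩
    · have := (hspace i).trans hJ1
      exact_mod_cast this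
    · have := huppt.trans hJ2
      exact_mod_cast this
  rw [setLAverage_eq, volume_upperPart x t hL]
  have hvol : ENNReal.ofReal (1 - γ) * boxVol n p k ≤
      ENNReal.ofReal ((2 * L) ^ n * ((1 - γ) * L ^ p)) := by
    rw [boxVol, ← ENNReal.ofReal_mul (by linarith)]
    apply ENNReal.ofReal_le_ofReal
    have h1γ : 0 ≤ 1 - γ := by linarith
    calc (1 - γ) * (2 : ℝ) ^ (-(n * spaceLevel p k + k))
        = ((2 : ℝ) ^ (-spaceLevel p k)) ^ n * ((1 - γ) * (2 : ℝ) ^ (-k)) := by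
          rw [neg_add, zpow_add₀ (by norm_num), ← zpow_natCast ((2 : ℝ) ^ (-spaceLevel p k)),
            ← zpow_mul, neg_mul, mul_comm (spaceLevel p k)]
          ring
      _ ≤ _ := by gcongr
  have hγ' : ENNReal.ofReal (1 - γ) ≠ 0 := by
    rw [Ne, ENNReal.ofReal_eq_zero, not_le]
    linarith
  calc (∫⁻ w in upperPart p γ x t L, ‖f w‖ₑ) / ENNReal.ofReal ((2 * L) ^ n * ((1 - γ) * L ^ p))
      = (∫⁻ w in upperPart p γ x t L, g w) / ENNReal.ofReal ((2 * L) ^ n * ((1 - γ) * L ^ p)) := by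
        rw [lintegral_congr_ae (ae_restrict_of_ae hfg)]
    _ ≤ (∑ v ∈ (indexBall n J).filter
          fun v => γ * y ^ p - 1 ≤ v.2 ∧ ∀ i, |(v.1 i : ℝ)| ≤ 2 * y + 1,
          ∫⁻ w in box p k (idx p k z + v), g w) / (ENNReal.ofReal (1 - γ) * boxVol n p k) :=
        ENNReal.div_le_div ((lintegral_mono_set hcover).trans
          (lintegral_union_finset_le _ _ _ _)) hvol
    _ = (ENNReal.ofReal (1 - γ))⁻¹ * ∑ v ∈ (indexBall n J).filter
          fun v => γ * y ^ p - 1 ≤ v.2 ∧ ∀ i, |(v.1 i : ℝ)| ≤ 2 * y + 1,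
          shiftMean p v g k (idx p k z) := by
        simp only [shiftMean, div_eq_mul_inv]
        rw [← Finset.sum_mul, ENNReal.mul_inv (Or.inl hγ') (Or.inl ENNReal.ofReal_ne_top)]
        ring
    _ ≤ _ := by
        gcongr with v hv
        refine le_trans ?_ (le_iSup _ (-k).toNat)
        exact le_iSup₂ (f := fun k' (_ : -(((-k).toNat : ℕ) : ℤ) ≤ k') =>
          shiftMean p v g k' (idx p k' z)) k (by omega)

/-- The shifts v - u' must be admissible because the decay moves dual mass from P + v back to P + v
- u', which still has to lie ahead of P. -/
theorem exists_forwardMaximal_strongType (hp : 1 ≤ p) (hq : 1 < q) (hγ0 : 0 < γ) (hγ1 : γ < 1)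
    {A : ℝ≥0∞} (hA : A ≠ ∞) {j : ℤ} (hj : 0 ≤ j) {u u' : Idx n} (huj : Near j u)
    (hu : GoodShift p q γ u) (hu' : ∀ e, Near (j + 3) e → GoodShift p q γ (u' + e))
    {y : ℝ} (hy0 : 0 ≤ y) (hy : 2 ≤ y ^ p)
    (hv : ∀ v : Idx n, γ * y ^ p - 1 ≤ v.2 → (∀ i, |(v.1 i : ℝ)| ≤ 2 * y + 1) →
      GoodShift p q γ (v - u')) :
    ∃ K : ℝ≥0∞, K ≠ ∞ ∧ ∀ W : SpaceTime n → ℝ≥0∞, Measurable W → (∀ z, W z ≠ ∞) →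
      RectangleCondition p q γ A W → ∀ (f : SpaceTime n → ℝ) (g : SpaceTime n → ℝ≥0∞),
        (fun z => ‖f z‖ₑ) =ᵐ[volume] g → Measurable g → (∀ z, g z ≠ ∞) →
        (∀ k (a : Idx n), ∫⁻ z in box p k a, g z ≠ ∞) →
          ∫⁻ z, forwardMaximal p γ f z ^ q * W z ≤ K * ∫⁻ z, g z ^ q * W z := by
  have hp0 : 0 < p := by linarith
  have hq0 : 0 < q := by linarith
  obtain ⟨s, hs, hmax⟩ := exists_forwardMaximal_le (n := n) hp0 hγ0 hγ1 hy0 hy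
  obtain ⟨C₁, hC₁, h₁⟩ := hu A hA
  obtain ⟨C₂, hC₂, h₂⟩ := exists_uniform_shiftCondition
    ((indexBall n (j + 3)).image fun e => u' + e) (by
      intro v hv
      obtain ⟨e, he, rfl⟩ := Finset.mem_image.1 hv
      exact hu' e (mem_indexBall.1 he)) hA
  obtain ⟨C₃, hC₃, h₃⟩ := exists_uniform_shiftCondition (s.image fun v => v - u') (by
      intro v' hv'
      obtain ⟨v, hvs, rfl⟩ := Finset.mem_image.1 hv'
      exact hv v (hs v hvs).1 (hs v hvs).2) hA
  set C := C₁ + C₂ + C₃ with hCdef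
  have hC : C ≠ ∞ := ENNReal.add_ne_top.2 ⟨ENNReal.add_ne_top.2 ⟨hC₁, hC₂⟩, hC₃⟩
  choose K hK hstrong using fun v : Idx n =>
    exists_dyadicMaximal_strongType (q := q) hp hq hC hj huj v
  set D := (ENNReal.ofReal (1 - γ))⁻¹ with hD
  have hDtop : D ≠ ∞ := by
    rw [hD, Ne, ENNReal.inv_eq_top, ENNReal.ofReal_eq_zero, not_le]
    linarith
  refine ⟨D ^ q * (s.card : ℝ≥0∞) ^ (q - 1) * ∑ v ∈ s, K v, ?_, ?_⟩
  · refine ENNReal.mul_ne_top (ENNReal.mul_ne_top (ENNReal.rpow_ne_top_of_nonneg hq0.le hDtop)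
      (ENNReal.rpow_ne_top_of_nonneg (by linarith) (by simp))) ?_
    exact (ENNReal.sum_lt_top.2 fun v _ => (hK v).lt_top).ne
  intro W hW hWtop hAW f g hfg hg hgtop hgint
  have hmeas : ∀ v : Idx n, Measurable fun z =>
      (⨆ m : ℕ, dyadicMaximal p v (-(m : ℤ)) g z) ^ q * W z := fun v =>
    ((Measurable.iSup fun m => measurable_dyadicMaximal v _ g).pow_const q).mul hW
  have hsup : ∀ v ∈ s, ∫⁻ z, (⨆ m : ℕ, dyadicMaximal p v (-(m : ℤ)) g z) ^ q * W z ≤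
      K v * ∫⁻ z, g z ^ q * W z := by
    intro v hvs
    have h1 : ∀ z, (⨆ m : ℕ, dyadicMaximal p v (-(m : ℤ)) g z) ^ q * W z =
        ⨆ m : ℕ, dyadicMaximal p v (-(m : ℤ)) g z ^ q * W z := by
      intro z
      rw [← ENNReal.iSup_mul]
      congr 1
      exact (ENNReal.orderIsoRpow q hq0).map_iSup _
    simp only [h1]
    -- Monotone convergence removes the restriction to generations at least -m, the bounds being
    -- uniform in m.
    rw [lintegral_iSup]
    · refine iSup_le fun m => ?_
      refine hstrong v W hW hWtop u' ((h₁ W hW hWtop hAW).mono ?_) (fun e he =>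
        (h₂ _ (Finset.mem_image_of_mem _ (mem_indexBall.2 he)) W hW hWtop hAW).mono ?_)
        ((h₃ _ (Finset.mem_image_of_mem _ hvs) W hW hWtop hAW).mono ?_) g hg hgtop hgint _
      · exact le_self_add.trans le_self_add
      · exact le_add_self.trans le_self_add
      · exact le_add_self
    · exact fun m => ((measurable_dyadicMaximal v _ g).pow_const q).mul hW
    · intro m m' hm z
      simp only
      gcongr
      refine iSup_mono fun k => iSup_mono' fun hk => ⟨?_, le_rfl⟩
      have : (m : ℤ) ≤ m' := by exact_mod_cast hm
      omega
  calc ∫⁻ z, forwardMaximal p γ f z ^ q * W z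
      ≤ ∫⁻ z, D ^ q * (s.card : ℝ≥0∞) ^ (q - 1) *
          ∑ v ∈ s, (⨆ m : ℕ, dyadicMaximal p v (-(m : ℤ)) g z) ^ q * W z := by
        refine lintegral_mono fun z => ?_
        calc forwardMaximal p γ f z ^ q * W z
            ≤ (D * ∑ v ∈ s, ⨆ m : ℕ, dyadicMaximal p v (-(m : ℤ)) g z) ^ q * W z := by
              gcongr
              exact hmax f g hfg z
          _ ≤ D ^ q * ((s.card : ℝ≥0∞) ^ (q - 1) *
                ∑ v ∈ s, (⨆ m : ℕ, dyadicMaximal p v (-(m : ℤ)) g z) ^ q) * W z := by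
              rw [ENNReal.mul_rpow_of_nonneg _ _ hq0.le]
              gcongr
              exact ENNReal.rpow_sum_le_const_mul_sum_rpow s _ hq.le
          _ = _ := by
              rw [← Finset.sum_mul]
              ring
    _ = D ^ q * (s.card : ℝ≥0∞) ^ (q - 1) *
          ∑ v ∈ s, ∫⁻ z, (⨆ m : ℕ, dyadicMaximal p v (-(m : ℤ)) g z) ^ q * W z := by
        rw [lintegral_const_mul _ (Finset.measurable_sum s fun v _ => hmeas v),
          lintegral_finsetSum s fun v _ => hmeas v]
    _ ≤ D ^ q * (s.card : ℝ≥0∞) ^ (q - 1) * ∑ v ∈ s, K v * ∫⁻ z, g z ^ q * W z := by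
        gcongr with v hvs
        exact hsup v hvs
    _ = _ := by
        rw [← Finset.sum_mul]
        ring

end Forward

end ParabolicWeights

namespace ParabolicWeights

/-! ### Choice of the shifts -/

section Choice

variable {n : ℕ} {p q γ : ℝ}

theorem directShift_of_le (hp : 0 < p) (hγ0 : 0 < γ) (hγ1 : γ < 1) {v : Idx n} {X : ℝ}
    (hX : 0 ≤ X) (h1 : 2 < (1 - γ) * v.2) (h2 : X ^ p ≤ (v.2 : ℝ) / 2)
    (h3 : ∀ i, |(v.1 i : ℝ)| + 1 ≤ X) : DirectShift p γ v := by
  have hT : 0 < (v.2 : ℝ) := by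
    by_contra! hc
    nlinarith
  have hΛ : ((v.2 : ℝ) + 1) / 2 < v.2 * (1 + γ) / (4 * γ) := by
    rw [lt_div_iff₀ (by positivity)]
    nlinarith
  -- The value is the midpoint of v.2 / 2 and v.2 / (2γ); the slack for the size of the boxes comes
  -- from 2 < (1 - γ) v.2.
  refine ⟨v.2 * (1 + γ) / (4 * γ), hΛ, ?_, by positivity, fun i => (h3 i).trans ?_⟩
  · rw [show γ * (v.2 * (1 + γ) / (4 * γ)) = v.2 * (1 + γ) / 4 by field_simp]
    linarith
  · calc X = (X ^ p) ^ (1 / p) := by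
          rw [← Real.rpow_mul hX, mul_one_div_cancel hp.ne', Real.rpow_one]
      _ ≤ _ := by
          gcongr
          linarith

/-- Each of N nearly equal pieces has spatial part at most about 3y/N and time lag at least γ y^p /
(2N). Directness asks for (3y/N)^p ≤ γ y^p / (4N), which is the assumption on N^{p-1}. -/
theorem goodShift_of_large (hp : 1 < p) (hq : 1 < q) (hγ0 : 0 < γ) (hγ1 : γ < 1) {N : ℕ}
    (hN0 : 1 ≤ N) (hN : 4 * 3 ^ p / γ ≤ (N : ℝ) ^ (p - 1)) {y : ℝ} (hyN : N * (N + 3) ≤ y)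
    {T : ℝ} (hy1 : 2 * (1 + T + N) ≤ γ * y ^ p) (hy2 : 4 * N < (1 - γ) * (γ * y ^ p))
    {w : Idx n} (hw : γ * y ^ p - 1 - T ≤ w.2) (hwx : ∀ i, |(w.1 i : ℝ)| ≤ 2 * y + 1) :
    GoodShift p q γ w := by
  have hp0 : 0 < p := by linarith
  have hN' : (1 : ℝ) ≤ N := by exact_mod_cast hN0
  have hNpos : (0 : ℝ) < N := by linarith
  have hy0 : 0 ≤ y := le_trans (by positivity) hyN
  have hNz : (0 : ℤ) < N := by exact_mod_cast hN0
  set X := 3 * y / N with hX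
  have hX0 : 0 ≤ X := by positivity
  have hdiv : ∀ m : ℤ, (m : ℝ) / N - 1 ≤ ((m / (N : ℤ) : ℤ) : ℝ) ∧
      ((m / (N : ℤ) : ℤ) : ℝ) ≤ (m : ℝ) / N := by
    intro m
    have h := Int.floor_div_natCast (m : ℝ) N
    rw [Int.floor_intCast] at h
    rw [← h]
    exact ⟨(Int.sub_one_lt_floor _).le, Int.floor_le _⟩
  have hdirect : ∀ d : Idx n, (w.2 : ℝ) / N - 1 ≤ d.2 →
      (∀ i, |(d.1 i : ℝ)| ≤ (2 * y + 1) / N + 1 + N) → GoodShift p q γ d := by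
    intro d hd hdx
    have hT : γ * y ^ p / (2 * N) ≤ d.2 := by
      refine le_trans ?_ hd
      rw [div_le_iff₀ (by positivity)]
      have : ((w.2 : ℝ) / N - 1) * (2 * N) = 2 * w.2 - 2 * N := by field_simp
      rw [this]
      linarith
    refine (directShift_of_le hp0 hγ0 hγ1 hX0 ?_ ?_ fun i => ?_).goodShift hp0 hq hγ0 hγ1
    · refine lt_of_lt_of_le ?_ (mul_le_mul_of_nonneg_left hT (by linarith))
      rw [← mul_div_assoc, lt_div_iff₀ (by positivity)]
      linarith
    · have hXp : X ^ p ≤ γ * y ^ p / (4 * N) := by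
        have h1 : X ^ p = 3 ^ p * y ^ p / (N ^ (p - 1) * N) := by
          rw [hX, Real.div_rpow (by positivity) hNpos.le, Real.mul_rpow (by norm_num) hy0]
          congr 1
          rw [← Real.rpow_add_one hNpos.ne', sub_add_cancel]
        rw [h1, div_le_div_iff₀ (by positivity) (by positivity)]
        rw [div_le_iff₀ hγ0] at hN
        have h2 : 0 ≤ y ^ p * N := by positivity
        nlinarith [mul_le_mul_of_nonneg_left hN h2]
      refine hXp.trans ?_
      rw [show γ * y ^ p / (4 * N) = γ * y ^ p / (2 * N) / 2 by ring]
      linarith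
    · have h1 := hdx i
      have h2 : (2 * y + 1) / N + 1 + N + 1 ≤ X := by
        rw [hX, le_div_iff₀ hNpos]
        have : ((2 * y + 1) / N + 1 + N + 1) * N = 2 * y + 1 + N * (N + 2) := by
          field_simp
          ring
        rw [this]
        nlinarith
      linarith
  set d : Idx n := (fun i => w.1 i / (N : ℤ), w.2 / (N : ℤ)) with hd
  have hdabs : ∀ i, |((w.1 i / (N : ℤ) : ℤ) : ℝ)| ≤ (2 * y + 1) / N + 1 := by
    intro i
    have h1 := hdiv (w.1 i)
    have h2 := abs_le.1 (hwx i)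
    have h3 : (w.1 i : ℝ) / N ≤ (2 * y + 1) / N := by gcongr; exact h2.2
    have h4 : -((2 * y + 1) / N) ≤ (w.1 i : ℝ) / N := by
      rw [← neg_div]
      gcongr
      exact h2.1
    rw [abs_le]
    constructor <;> linarith
  have hrem : ∀ m : ℤ, m - (N - 1 : ℕ) * (m / (N : ℤ)) = m / (N : ℤ) + m % N := by
    intro m
    have := Int.mul_ediv_add_emod m N
    push_cast [Nat.cast_sub hN0]
    linarith
  have hmod : ∀ m : ℤ, (0 : ℝ) ≤ ((m % (N : ℤ) : ℤ) : ℝ) ∧ ((m % (N : ℤ) : ℤ) : ℝ) ≤ N := by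
    intro m
    constructor
    · exact_mod_cast Int.emod_nonneg m hNz.ne'
    · exact_mod_cast (Int.emod_lt_of_pos m hNz).le
  -- N - 1 copies of the integer quotient by N, and a last piece that also takes the remainder.
  have hsplit : w = (N - 1) • d + (w - (N - 1) • d) := by abel
  rw [hsplit]
  refine GoodShift.nsmul_add hq (hdirect d (hdiv w.2).1 fun i => ?_) (hdirect _ ?_ fun i => ?_) _
  · exact (hdabs i).trans (by linarith)
  · have h : (w - (N - 1) • d).2 = w.2 / (N : ℤ) + w.2 % N := by
      rw [← hrem]
      simp [hd]
    rw [h]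
    push_cast
    linarith [(hdiv w.2).1, (hmod w.2).1]
  · have h : (w - (N - 1) • d).1 i = w.1 i / (N : ℤ) + w.1 i % N := by
      rw [← hrem]
      simp [hd]
    rw [h]
    push_cast
    refine (abs_add_le _ _).trans (add_le_add (hdabs i) ?_)
    rw [abs_of_nonneg (hmod _).1]
    exact (hmod _).2

/-- The order of choice matters: the lag T₀ of `u` fixes the radius j, then the lag T₁ of `u'` must
beat the p-th power of that radius, then N is chosen from p and γ, and y last, large against T₁ and
N. -/
theorem exists_goodShifts (n : ℕ) (hp : 1 < p) (hq : 1 < q) (hγ0 : 0 < γ) (hγ1 : γ < 1) :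
    ∃ (j : ℤ) (u u' : Idx n) (y : ℝ), 0 ≤ j ∧ Near j u ∧ GoodShift p q γ u ∧
      (∀ e, Near (j + 3) e → GoodShift p q γ (u' + e)) ∧ 0 ≤ y ∧ 2 ≤ y ^ p ∧
      ∀ v : Idx n, γ * y ^ p - 1 ≤ v.2 → (∀ i, |(v.1 i : ℝ)| ≤ 2 * y + 1) →
        GoodShift p q γ (v - u') := by
  have hp0 : 0 < p := by linarith
  have h1γ : 0 < 1 - γ := by linarith
  obtain ⟨T₀, hT₀⟩ := exists_int_gt (2 / (1 - γ) + 2)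
  have hdiv0 : 0 < 2 / (1 - γ) := by positivity
  have hT₀0 : (0 : ℝ) < T₀ := by linarith
  have hj : 0 ≤ T₀ := by exact_mod_cast hT₀0.le
  obtain ⟨T₁, hT₁⟩ := exists_int_gt (2 / (1 - γ) + 2 * ((T₀ : ℝ) + 4) ^ p + (T₀ + 3))
  have hmul : ∀ T : ℝ, 2 / (1 - γ) < T → 2 < (1 - γ) * T := fun T h => by
    rwa [div_lt_iff₀ h1γ, mul_comm] at h
  obtain ⟨N₀, hN₀⟩ := ((tendsto_rpow_atTop (show 0 < p - 1 by linarith)).comp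
    tendsto_natCast_atTop_atTop).eventually_ge_atTop (4 * 3 ^ p / γ) |>.exists_forall_of_atTop
  set N := max N₀ 1 with hN
  have hN1 : 1 ≤ N := le_max_right _ _
  set y := max (max 2 (N * (N + 3) : ℝ)) (max (2 * (1 + T₁ + N) / γ) (4 * N / ((1 - γ) * γ) + 1))
    with hy
  have hy2 : 2 ≤ y := (le_max_left _ _).trans (le_max_left _ _)
  have hyN : (N * (N + 3) : ℝ) ≤ y := (le_max_right _ _).trans (le_max_left _ _)
  have hyT : 2 * (1 + T₁ + N) / γ ≤ y := (le_max_left _ _).trans (le_max_right _ _)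
  have hyγ : 4 * N / ((1 - γ) * γ) < y :=
    lt_of_lt_of_le (lt_add_one _) ((le_max_right _ _).trans (le_max_right _ _))
  have hyp : y ≤ y ^ p := Real.self_le_rpow_of_one_le (by linarith) hp.le
  refine ⟨T₀, (0, T₀), (0, T₁), y, hj, ⟨fun i => by simpa using hj, by simp [abs_of_nonneg hj]⟩,
    ?_, ?_, by linarith, by linarith, ?_⟩
  · refine (directShift_of_le hp0 hγ0 hγ1 (X := 1) zero_le_one ?_ ?_ fun i => ?_).goodShift hp0 hq
      hγ0 hγ1
    · exact hmul _ (by simp only; linarith)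
    · rw [Real.one_rpow]
      simp only
      linarith
    · simp
  · intro e he
    have he2 : -((T₀ : ℝ) + 3) ≤ e.2 := by exact_mod_cast (abs_le.1 he.2).1
    have hXp : 0 ≤ ((T₀ : ℝ) + 4) ^ p := by positivity
    refine (directShift_of_le hp0 hγ0 hγ1 (X := T₀ + 4) (by linarith) ?_ ?_
      fun i => ?_).goodShift hp0 hq hγ0 hγ1
    · refine hmul _ ?_
      simp only [Prod.snd_add, Int.cast_add]
      linarith
    · simp only [Prod.snd_add, Int.cast_add]
      linarith
    · have : |(e.1 i : ℝ)| ≤ T₀ + 3 := by exact_mod_cast he.1 i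
      simp only [Prod.fst_add, Pi.add_apply, Pi.zero_apply, zero_add]
      linarith
  · intro v hv hvx
    refine goodShift_of_large hp hq hγ0 hγ1 hN1 (hN₀ N (le_max_left _ _)) hyN (T := T₁) (y := y)
      ?_ ?_ ?_ ?_
    · rw [div_le_iff₀ hγ0] at hyT
      nlinarith
    · rw [div_lt_iff₀ (by positivity)] at hyγ
      have : 0 < (1 - γ) * γ := by positivity
      nlinarith
    · simp only [Prod.snd_sub, Int.cast_sub]
      linarith
    · simpa using hvx

end Choice

end ParabolicWeights

namespace ParabolicWeights

/-! ### Necessity and sufficiency of the Muckenhoupt condition -/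

section Main

variable {n : ℕ} {p q γ : ℝ}

/-! ### Necessity -/

theorem rpow_mul_self_of_dual (hq : 1 < q) {s : ℝ≥0∞} (h0 : s ≠ 0) (htop : s ≠ ∞) :
    (s ^ (1 / (1 - q))) ^ q * s = s ^ (1 / (1 - q)) := by
  rw [← ENNReal.rpow_mul]
  conv_lhs => rw [← ENNReal.rpow_one s, ← ENNReal.rpow_mul]
  rw [← ENNReal.rpow_add _ _ (by simpa using h0) (by simpa using htop)]
  congr 1
  have : 1 - q ≠ 0 := by linarith
  field_simp
  ring

theorem rpow_le_rpow_of_nonpos {a b : ℝ≥0∞} (h : a ≤ b) {r : ℝ} (hr : r ≤ 0) :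
    b ^ r ≤ a ^ r := by
  rw [← neg_neg r, ENNReal.rpow_neg b, ENNReal.rpow_neg a, ENNReal.inv_le_inv]
  exact ENNReal.rpow_le_rpow h (by linarith)

/-- Testing the strong type estimate on a truncation of the dual weight. -/
theorem StrongType.average_mul_le (hq : 1 < q) (hγ1 : γ < 1)
    {w : SpaceTime n → ℝ} (hw : IsWeight w) {C : ℝ} (h : StrongType p q γ w C)
    (x : Fin n → ℝ) (t : ℝ) {L : ℝ} (hL : 0 < L) {ε : ℝ} (hε : 0 < ε) :
    (⨍⁻ z in lowerPart p γ x t L, ENNReal.ofReal (w z) ∂volume) *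
      (⨍⁻ z in upperPart p γ x t L,
        (ENNReal.ofReal (w z) + ENNReal.ofReal ε) ^ (1 / (1 - q)) ∂volume) ^ (q - 1) ≤
          ENNReal.ofReal C := by
  have hq0 : 0 < q := by linarith
  have hr : 1 / (1 - q) < 0 := div_neg_of_pos_of_neg one_pos (by linarith)
  set R := ENNReal.ofReal ((2 * L) ^ n * ((1 - γ) * L ^ p)) with hR
  have hR0 : R ≠ 0 := by
    rw [hR, Ne, ENNReal.ofReal_eq_zero, not_le]
    have : 0 < 1 - γ := by linarith
    positivity
  have hRtop : R ≠ ∞ := ENNReal.ofReal_ne_top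
  set U := upperPart p γ x t L with hU
  have hUm : MeasurableSet U := measurableSet_upperPart x t L
  have hUvol : volume U = R := volume_upperPart x t hL
  set F : SpaceTime n → ℝ≥0∞ := fun z =>
    (ENNReal.ofReal (w z) + ENNReal.ofReal ε) ^ (1 / (1 - q)) with hF
  -- Adding ε bounds the dual weight, so the test function is integrable even where w vanishes.
  set f : SpaceTime n → ℝ := U.indicator fun z => (w z + ε) ^ (1 / (1 - q)) with hf
  have hpos : ∀ z, 0 < w z + ε := fun z => by linarith [hw.1 z]
  have hFf : ∀ z, ‖f z‖ₑ = U.indicator F z := by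
    intro z
    by_cases hz : z ∈ U
    · rw [hf, Set.indicator_of_mem hz, Set.indicator_of_mem hz,
        Real.enorm_of_nonneg (Real.rpow_nonneg (hpos z).le _)]
      simp only [hF]
      rw [← ENNReal.ofReal_add (hw.1 z) hε.le, ENNReal.ofReal_rpow_of_pos (hpos z)]
    · rw [hf, Set.indicator_of_notMem hz, Set.indicator_of_notMem hz, enorm_zero]
  have hfint : LocallyIntegrable f := by
    refine Integrable.locallyIntegrable ?_
    rw [hf, integrable_indicator_iff hUm]
    refine Measure.integrableOn_of_bounded (M := ε ^ (1 / (1 - q))) (by rw [hUvol]; exact hRtop)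
      ?_ ?_
    · have := hw.2.aestronglyMeasurable.aemeasurable
      exact ((this.add_const ε).pow_const _).aestronglyMeasurable
    · refine Filter.Eventually.of_forall fun z => ?_
      rw [Real.norm_of_nonneg (Real.rpow_nonneg (hpos z).le _)]
      exact Real.rpow_le_rpow_of_nonpos hε (by linarith [hw.1 z]) hr.le
  have hFtop : ∫⁻ z in U, F z ≠ ∞ := by
    have hle : ∀ z, F z ≤ ENNReal.ofReal ε ^ (1 / (1 - q)) := fun z =>
      rpow_le_rpow_of_nonpos le_add_self hr.le
    refine ne_top_of_le_ne_top ?_ (lintegral_mono hle)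
    rw [lintegral_const, Measure.restrict_apply_univ, hUvol]
    refine ENNReal.mul_ne_top ?_ hRtop
    rw [ENNReal.ofReal_rpow_of_pos hε]
    exact ENNReal.ofReal_ne_top
  set X := ⨍⁻ z in U, F z ∂volume with hX
  have hXR : ∫⁻ z in U, F z = X * R := by
    rw [hX, setLAverage_eq, hUvol, ENNReal.div_mul_cancel hR0 hRtop]
  have hXtop : X ≠ ∞ := by
    rw [hX, setLAverage_eq, hUvol]
    exact ENNReal.div_ne_top hFtop hR0
  have hlow : ∀ z ∈ lowerPart p γ x t L, X ≤ forwardMaximal p γ f z := by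
    intro z hz
    have : X = ⨍⁻ y in upperPart p γ x t L, ‖f y‖ₑ ∂volume := by
      rw [hX, setLAverage_eq, setLAverage_eq]
      congr 1
      refine setLIntegral_congr_fun hUm fun y hy => ?_
      rw [hFf, Set.indicator_of_mem hy]
    rw [this]
    exact le_iSup_of_le x (le_iSup_of_le t (le_iSup_of_le L (le_iSup_of_le hL
      (le_iSup_of_le hz le_rfl))))
  have hmain : X ^ q * ∫⁻ z in lowerPart p γ x t L, ENNReal.ofReal (w z) ≤
      ENNReal.ofReal C * (X * R) := by
    calc X ^ q * ∫⁻ z in lowerPart p γ x t L, ENNReal.ofReal (w z)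
        = ∫⁻ z in lowerPart p γ x t L, X ^ q * ENNReal.ofReal (w z) :=
          (lintegral_const_mul' _ _ (ENNReal.rpow_ne_top_of_nonneg hq0.le hXtop)).symm
      _ ≤ ∫⁻ z in lowerPart p γ x t L, forwardMaximal p γ f z ^ q * ENNReal.ofReal (w z) := by
          refine setLIntegral_mono' (measurableSet_lowerPart x t L) fun z hz => ?_
          gcongr
          exact hlow z hz
      _ ≤ ∫⁻ z, forwardMaximal p γ f z ^ q * ENNReal.ofReal (w z) := setLIntegral_le_lintegral _ _
      _ ≤ ENNReal.ofReal C * ∫⁻ z, ‖f z‖ₑ ^ q * ENNReal.ofReal (w z) := h f hfint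
      _ ≤ ENNReal.ofReal C * ∫⁻ z, U.indicator F z := by
          gcongr with z
          rw [hFf]
          by_cases hz : z ∈ U
          · rw [Set.indicator_of_mem hz]
            calc F z ^ q * ENNReal.ofReal (w z)
                ≤ F z ^ q * (ENNReal.ofReal (w z) + ENNReal.ofReal ε) := by
                  gcongr
                  exact le_self_add
              _ = F z := rpow_mul_self_of_dual hq (by simp [hε]) (by simp)
          · rw [Set.indicator_of_notMem hz, ENNReal.zero_rpow_of_pos hq0, zero_mul]
      _ = ENNReal.ofReal C * (X * R) := by rw [lintegral_indicator hUm, hXR]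
  rw [setLAverage_eq, volume_lowerPart x t hL]
  rcases eq_or_ne X 0 with hX0 | hX0
  · rw [hX0, ENNReal.zero_rpow_of_pos (by linarith), mul_zero]
    exact zero_le
  · rw [ENNReal.div_eq_inv_mul, mul_assoc, ← ENNReal.div_eq_inv_mul,
      ENNReal.div_le_iff hR0 hRtop, ← ENNReal.mul_le_mul_iff_right hX0 hXtop]
    calc X * ((∫⁻ z in lowerPart p γ x t L, ENNReal.ofReal (w z)) * X ^ (q - 1))
        = X ^ q * ∫⁻ z in lowerPart p γ x t L, ENNReal.ofReal (w z) := by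
          rw [mul_left_comm, mul_comm]
          congr 1
          nth_rw 1 [← ENNReal.rpow_one X]
          rw [← ENNReal.rpow_add _ _ hX0 hXtop, add_sub_cancel]
      _ ≤ ENNReal.ofReal C * (X * R) := hmain
      _ = _ := by ring

/-- The regularised dual weights increase to the dual weight as ε decreases to 0, with limit ∞ where
w = 0, so monotone convergence applies with the bound uniform in ε. -/
theorem StrongType.muckenhouptConst_le (hq : 1 < q) (hγ1 : γ < 1)
    {w : SpaceTime n → ℝ} (hw : IsWeight w) {C : ℝ} (h : StrongType p q γ w C) :
    muckenhouptConst p q γ w ≤ ENNReal.ofReal C := by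
  have hq1 : 0 < q - 1 := by linarith
  have hr : 1 / (1 - q) < 0 := div_neg_of_pos_of_neg one_pos (by linarith)
  refine iSup_le fun x => iSup_le fun t => iSup_le fun L => iSup_le fun hL => ?_
  set ε : ℕ → ℝ := fun m => 1 / ((m : ℝ) + 1) with hε
  have hε0 : ∀ m, 0 < ε m := fun m => by positivity
  have hεanti : Antitone ε := fun m m' hm => by
    simp only [hε]
    gcongr
  set F : ℕ → SpaceTime n → ℝ≥0∞ := fun m z =>
    (ENNReal.ofReal (w z) + ENNReal.ofReal (ε m)) ^ (1 / (1 - q)) with hF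
  have hmono : ∀ z, Monotone fun m => F m z := fun z m m' hm =>
    rpow_le_rpow_of_nonpos (by gcongr; exact hεanti hm) hr.le
  have hsup : ∀ z, ENNReal.ofReal (w z) ^ (1 / (1 - q)) = ⨆ m, F m z := by
    intro z
    refine (iSup_eq_of_tendsto (hmono z) ?_).symm
    refine (ENNReal.continuous_rpow_const.tendsto _).comp ?_
    have h1 : Filter.Tendsto (fun m => ENNReal.ofReal (ε m)) Filter.atTop (nhds 0) := by
      rw [← ENNReal.ofReal_zero]
      exact ENNReal.tendsto_ofReal tendsto_one_div_add_atTop_nhds_zero_nat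
    simpa using h1.const_add (ENNReal.ofReal (w z))
  have hlim : ⨍⁻ z in upperPart p γ x t L, ENNReal.ofReal (w z) ^ (1 / (1 - q)) ∂volume =
      ⨆ m, ⨍⁻ z in upperPart p γ x t L, F m z ∂volume := by
    simp only [setLAverage_eq, hsup]
    simp only [ENNReal.div_eq_inv_mul]
    rw [lintegral_iSup', ENNReal.mul_iSup]
    · intro m
      have := hw.2.aestronglyMeasurable.aemeasurable
      exact ((this.ennreal_ofReal.add_const _).pow_const _).restrict
    · exact Filter.Eventually.of_forall hmono
  rw [hlim, ← ENNReal.orderIsoRpow_apply (q - 1) hq1, OrderIso.map_iSup, ENNReal.mul_iSup]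
  refine iSup_le fun m => ?_
  rw [ENNReal.orderIsoRpow_apply]
  exact h.average_mul_le hq hγ1 hw x t hL (hε0 m)

/-! ### Sufficiency -/

theorem rectangleCondition_of_ae_eq {w : SpaceTime n → ℝ} {W : SpaceTime n → ℝ≥0∞}
    (hW : (fun z => ENNReal.ofReal (w z)) =ᵐ[volume] W) :
    RectangleCondition p q γ (muckenhouptConst p q γ w) W := by
  intro x t L hL
  have h1 : ⨍⁻ z in lowerPart p γ x t L, W z ∂volume =
      ⨍⁻ z in lowerPart p γ x t L, ENNReal.ofReal (w z) ∂volume := by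
    rw [setLAverage_eq, setLAverage_eq, lintegral_congr_ae (ae_restrict_of_ae hW)]
  have h2 : ⨍⁻ z in upperPart p γ x t L, W z ^ (1 / (1 - q)) ∂volume =
      ⨍⁻ z in upperPart p γ x t L, ENNReal.ofReal (w z) ^ (1 / (1 - q)) ∂volume := by
    rw [setLAverage_eq, setLAverage_eq]
    congr 1
    refine lintegral_congr_ae (ae_restrict_of_ae ?_)
    filter_upwards [hW] with z hz
    rw [hz]
  rw [h1, h2]
  exact le_iSup_of_le x (le_iSup_of_le t (le_iSup_of_le L (le_iSup_of_le hL le_rfl)))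

theorem lintegral_box_enorm_ne_top {f : SpaceTime n → ℝ} (hf : LocallyIntegrable f) (k : ℤ)
    (a : Idx n) : ∫⁻ z in box p k a, ‖f z‖ₑ ≠ ∞ := by
  have hcompact : IsCompact ((Set.univ.pi fun i =>
      Set.Icc (a.1 i * (2 : ℝ) ^ (-spaceLevel p k)) ((a.1 i + 1) * (2 : ℝ) ^ (-spaceLevel p k))) ×ˢ
        Set.Icc (a.2 * (2 : ℝ) ^ (-k)) ((a.2 + 1) * (2 : ℝ) ^ (-k))) :=
    (isCompact_univ_pi fun _ => isCompact_Icc).prod isCompact_Icc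
  have hsub : box p k a ⊆ _ := (box_eq_prod k a).trans_subset
    (Set.prod_mono (Set.pi_mono fun i _ => Set.Ico_subset_Icc_self) Set.Ico_subset_Icc_self)
  exact ((hf.integrableOn_isCompact hcompact).mono_set hsub).2.ne

/-- Fixing the value `a` before `w` makes the constant depend only on n, p, q, γ and the Muckenhoupt
constant. -/
theorem exists_strongType_const (n : ℕ) (hp : 1 < p) (hq : 1 < q) (hγ0 : 0 < γ) (hγ1 : γ < 1)
    (a : ℝ) :
    ∃ C : ℝ, 0 < C ∧ ∀ w : SpaceTime n → ℝ, IsWeight w →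
      muckenhouptConst p q γ w = ENNReal.ofReal a → StrongType p q γ w C := by
  obtain ⟨j, u, u', y, hj, huj, hu, hu', hy0, hy, hv⟩ := exists_goodShifts n hp hq hγ0 hγ1
  obtain ⟨K, hK, hstrong⟩ := exists_forwardMaximal_strongType hp.le hq hγ0 hγ1
    (A := ENNReal.ofReal a) ENNReal.ofReal_ne_top hj huj hu hu' hy0 hy hv
  refine ⟨K.toReal + 1, by positivity, fun w hw hwa f hf => ?_⟩
  have hwm := hw.2.aestronglyMeasurable
  have hfm := hf.aestronglyMeasurable
  -- Measurable representatives suffice, since all averages and integrals ignore null sets.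
  set W : SpaceTime n → ℝ≥0∞ := fun z => ENNReal.ofReal (hwm.mk w z) with hW
  have hwW : (fun z => ENNReal.ofReal (w z)) =ᵐ[volume] W := by
    filter_upwards [hwm.ae_eq_mk] with z hz
    rw [hW, hz]
  set g : SpaceTime n → ℝ≥0∞ := fun z => ‖hfm.mk f z‖ₑ with hg
  have hfg : (fun z => ‖f z‖ₑ) =ᵐ[volume] g := by
    filter_upwards [hfm.ae_eq_mk] with z hz
    rw [hg, hz]
  have hrect := rectangleCondition_of_ae_eq (p := p) (q := q) (γ := γ) hwW
  rw [hwa] at hrect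
  have h := hstrong W hwm.stronglyMeasurable_mk.measurable.ennreal_ofReal
    (fun z => ENNReal.ofReal_ne_top) hrect f g hfg hfm.stronglyMeasurable_mk.measurable.enorm
    (fun z => enorm_ne_top) fun k b => by
      rw [← lintegral_congr_ae (ae_restrict_of_ae hfg)]
      exact lintegral_box_enorm_ne_top hf k b
  calc ∫⁻ z, forwardMaximal p γ f z ^ q * ENNReal.ofReal (w z)
      = ∫⁻ z, forwardMaximal p γ f z ^ q * W z := by
        refine lintegral_congr_ae ?_
        filter_upwards [hwW] with z hz
        rw [hz]
    _ ≤ K * ∫⁻ z, g z ^ q * W z := h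
    _ = K * ∫⁻ z, ‖f z‖ₑ ^ q * ENNReal.ofReal (w z) := by
        congr 1
        refine lintegral_congr_ae ?_
        filter_upwards [hwW, hfg] with z hz hz'
        rw [hz, hz']
    _ ≤ _ := by
        gcongr
        rw [← ENNReal.ofReal_toReal hK]
        exact ENNReal.ofReal_le_ofReal (by rw [ENNReal.ofReal_toReal hK]; linarith)

end Main

end ParabolicWeights

theorem mainTheorem4 (n : ℕ) (hn : 1 ≤ n) (p q γ : ℝ) (hp : 1 < p) (hq : 1 < q)
    (hγ0 : 0 < γ) (hγ1 : γ < 1) :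
    (∀ w : ParabolicWeights.SpaceTime n → ℝ, ParabolicWeights.IsWeight w →
      (ParabolicWeights.MemMuckenhoupt p q γ w ↔
        ∃ C : ℝ, 0 < C ∧ ParabolicWeights.StrongType p q γ w C)) ∧
    (∃ C : ℝ → ℝ, (∀ a, 0 < C a) ∧
      ∀ w : ParabolicWeights.SpaceTime n → ℝ, ParabolicWeights.IsWeight w →
        ParabolicWeights.MemMuckenhoupt p q γ w →
          ParabolicWeights.StrongType p q γ w
            (C (ParabolicWeights.muckenhouptConst p q γ w).toReal)) := by
  choose C hC hstrong using ParabolicWeights.exists_strongType_const n hp hq hγ0 hγ1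
  have hC' : ∀ w : ParabolicWeights.SpaceTime n → ℝ, ParabolicWeights.IsWeight w →
      ParabolicWeights.MemMuckenhoupt p q γ w → ParabolicWeights.StrongType p q γ w
        (C (ParabolicWeights.muckenhouptConst p q γ w).toReal) := fun w hw hmem =>
    hstrong _ w hw (ENNReal.ofReal_toReal hmem.ne).symm
  refine ⟨fun w hw => ⟨fun hmem => ⟨_, hC _, hC' w hw hmem⟩, ?_⟩, C, hC, hC'⟩
  rintro ⟨C₀, -, h⟩
  exact (h.muckenhouptConst_le hq hγ1 hw).trans_lt ENNReal.ofReal_lt_top
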